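/- Let $\rho, c_p, \lambda > 0$ and $u_{\mathrm{init}}$ be constants and put $\kappa = \lambda/(\rho c_p)$. Let $0 = t_0 < t_1 < \dots < t_N = T$. For $n = 1, \dots, N$ put $t_n^{\mathrm i} = t_{n-1}$, $t_n^{\mathrm f} = t_n$, and let a beam power $P_n \in \mathbb{R}$, a spot size $\sigma_n > 0$, a velocity $(v_{n,x}, v_{n,y}) = (v_n \cos\alpha_n, v_n \sin\alpha_n)$ with speed $v_n \ge 0$, and an initial position $(x_n^{\mathrm i}, y_n^{\mathrm i})$ be given. For $t \in (t_n^{\mathrm i}, t_n^{\mathrm f}]$ let $P(t) = P_n$, $\sigma(t) = \sigma_n$, and $(x_c(t), y_c(t)) = (x_n^{\mathrm i}, y_n^{\mathrm i}) + (t - t_n^{\mathrm i})(v_{n,x}, v_{n,y})$; let $(x_n^{\mathrm f}, y_n^{\mathrm f})$ be the position at $t = t_n^{\mathrm f}$. Let $$\Phi(x,y,t) = \frac{P(t)}{2\pi\sigma(t)^2} \exp\Big(-\frac{(x-x_c(t))^2 + (y-y_c(t))^2}{2\sigma(t)^2}\Big).$$ Consider the problem $$\rho c_p\, \partial_t u -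 \lambda \Delta u = 0 \ \text{ for } z < 0,\ 0 < t \le T, \qquad \lambda\, \partial_z u = \Phi \ \text{ on } z = 0,\ 0 < t \le T, \qquad u(\cdot, 0) = u_{\mathrm{init}}.$$ A solution is understood here as a bounded classical one: $u$ is bounded and continuous on $\{z \le 0\} \times [0,T]$, is $C^2$ in space and differentiable in time at the points with $z < 0$, $0 < t \le T$ (the time derivative at $t = T$ being one-sided), and has at $z = 0$ the one-sided normal derivative $\Phi/\lambda$. Let $G(\mathbf{x},t) = (4\pi\kappa t)^{-3/2} e^{-|\mathbf{x}|^2/(4\kappa t)}$, let $*$ be the convolution over $\mathbb{R}^3$, and for $\mathbf{x} = (x,y,z) \in \mathbb{R}^3$ put $$u_n^\Phi(\mathbf{x},t) = \frac{2}{\rho c_p} \int_{t_n^{\mathrm i}}^{t} \int_{\mathbb{R}^2} G(x-\xi, y-\eta, z, t-s)\, \Phi(\xi,\eta,s)\, d\xi\, d\eta\, ds \qquad (t \in (t_n^{\mathrm i}, t_n^{\mathrm f}]),$$ $$u_{n,k}^{\mathrm I}(\mathbf{x},t) = \big(G(\cdot, t - t_k^{\mathrm f}) * u_k^\Phi(\cdot,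 t_k^{\mathrm f})\big)(\mathbf{x}) \qquad (k < n,\ t \in (t_n^{\mathrm i}, t_n^{\mathrm f}]).$$ Then the problem has a solution, and every solution $u$ satisfies, for $n = 1, \dots, N$, $t \in (t_n^{\mathrm i}, t_n^{\mathrm f}]$ and $z \le 0$, $$u(\mathbf{x},t) = u_n^{\mathrm I}(\mathbf{x},t) + u_n^\Phi(\mathbf{x},t) = u_{\mathrm{init}} + \sum_{k=1}^{n-1} u_{n,k}^{\mathrm I}(\mathbf{x},t) + u_n^\Phi(\mathbf{x},t),$$ where $u_n^{\mathrm I}(\cdot,t) = G(\cdot, t - t_n^{\mathrm i}) * u(\cdot, t_n^{\mathrm i})$, with $u(\cdot, t_n^{\mathrm i})$ extended to $\mathbb{R}^3$ as an even function of $z$ (in particular, the solution is unique). Moreover, for all $\mathbf{x} \in \mathbb{R}^3$, the following holds. (a) For $t \in (t_n^{\mathrm i}, t_n^{\mathrm f}]$, with $T_n = \frac{P_n}{\sqrt2\, \pi^{3/2} \lambda \sigma_n}$, $\bar v_{n,x} = \frac{v_{n,x}\sigma_n}{2\sqrt2\,\kappa}$, $\bar v_{n,y} = \frac{v_{n,y}\sigma_n}{2\sqrt2\,\kappa}$,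 $\bar x_n = \frac{x - x_n^{\mathrm i} - v_{n,x}(t-t_n^{\mathrm i})}{\sqrt2\,\sigma_n}$, $\bar y_n = \frac{y - y_n^{\mathrm i} - v_{n,y}(t-t_n^{\mathrm i})}{\sqrt2\,\sigma_n}$, $\bar z_n = \frac{z}{\sqrt2\,\sigma_n}$ and $\bar t_n = \frac{\sqrt{2\kappa(t-t_n^{\mathrm i})}}{\sigma_n}$, $$u_n^\Phi(\mathbf{x},t) = T_n \int_0^{\bar t_n} \frac{1}{1+\bar s^2} \exp\Big(-\frac{(\bar x_n + \bar v_{n,x}\bar s^2)^2 + (\bar y_n + \bar v_{n,y}\bar s^2)^2}{1+\bar s^2} - \frac{\bar z_n^2}{\bar s^2}\Big)\, d\bar s.$$ (b) For $k < n$ and $t \in (t_n^{\mathrm i}, t_n^{\mathrm f}]$, with $T_k, \bar v_{k,x}, \bar v_{k,y}$ as in (a) and now $\bar x_k = \frac{x - x_k^{\mathrm f}}{\sqrt2\,\sigma_k}$, $\bar y_k = \frac{y - y_k^{\mathrm f}}{\sqrt2\,\sigma_k}$, $\bar z_k = \frac{z}{\sqrt2\,\sigma_k}$, $\bar t_k =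 \frac{\sqrt{2\kappa(t-t_k^{\mathrm f})}}{\sigma_k}$ and $\bar t_k^{\mathrm f} = \frac{\sqrt{2\kappa(t_k^{\mathrm f}-t_k^{\mathrm i})}}{\sigma_k}$, $$u_{n,k}^{\mathrm I}(\mathbf{x},t) = \frac{T_k}{\pi^{3/2}\, \bar t_k^3} \int_0^{\bar t_k^{\mathrm f}} \frac{1}{1+\bar r^2}\, J(\bar v_{k,x}; \bar x_k, \bar t_k, \bar r)\, J(\bar v_{k,y}; \bar y_k, \bar t_k, \bar r)\, J_{\bar\zeta}(\bar z_k, \bar t_k, \bar r)\, d\bar r$$ $$= T_k \int_0^{\bar t_k^{\mathrm f}} \frac{\bar r\, (\bar r^2 + \bar t_k^2)^{-1/2}}{1 + \bar r^2 + \bar t_k^2} \exp\Big(-\frac{(\bar x_k + \bar v_{k,x}\bar r^2)^2 + (\bar y_k + \bar v_{k,y}\bar r^2)^2}{1 + \bar r^2 + \bar t_k^2} - \frac{\bar z_k^2}{\bar r^2 + \bar t_k^2}\Big)\, d\bar r .$$ (c) Here, for $a, b \in \mathbb{R}$ and $\tau, r > 0$, $$J(b; a, \tau, r) = \int_{-\infty}^{\infty}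 \exp\Big(-\frac{(a-\xi)^2}{\tau^2} - \frac{(\xi + b r^2)^2}{1+r^2}\Big) d\xi = \sqrt{\frac{\pi \tau^2 (1+r^2)}{1+r^2+\tau^2}}\; \exp\Big(-\frac{(a + b r^2)^2}{1+r^2+\tau^2}\Big),$$ $$J_{\bar\zeta}(a, \tau, r) = \int_{-\infty}^{\infty} \exp\Big(-\frac{(a-\zeta)^2}{\tau^2} - \frac{\zeta^2}{r^2}\Big) d\zeta = \sqrt{\frac{\pi \tau^2 r^2}{r^2+\tau^2}}\; \exp\Big(-\frac{a^2}{r^2+\tau^2}\Big).$$ -/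

import Mathlib

open Set MeasureTheory
open scoped Convolution Laplacian

noncomputable section

namespace BeamHeat

/-- Points `(x, y, z)` of space. -/
abbrev Space := EuclideanSpace ℝ (Fin 3)

/-- Constant material parameters: density, heat capacity, thermal conductivity. -/
structure Material where
  density : ℝ
  heatCapacity : ℝ
  conductivity : ℝ
  density_pos : 0 < density
  heatCapacity_pos : 0 < heatCapacity
  conductivity_pos : 0 < conductivity

/-- The thermal diffusivity `κ = λ / (ρ c_p)`. -/
def Material.diffusivity (m : Material) : ℝ :=
  m.conductivity / (m.density * m.heatCapacity)

/-- A time partition `0 = t_0 < t_1 < ... < t_N` with the data of its `N` segments. The segments are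
indexed from `0`: segment `n : Fin N` is the interval `(time n.castSucc, time n.succ]`. On it, the
beam has constant power, spot size and speed, and it starts at `(startX n, startY n)` and runs along
a straight line that makes the angle `angle n` with the `x`-axis. -/
structure BeamSchedule (N : ℕ) where
  time : Fin (N + 1) → ℝ
  time_zero : time 0 = 0
  time_strictMono : StrictMono time
  power : Fin N → ℝ
  spot : Fin N → ℝ
  spot_pos : ∀ n, 0 < spot n
  speed : Fin N → ℝ
  speed_nonneg : ∀ n, 0 ≤ speed n
  angle : Fin N → ℝ
  startX : Fin N → ℝ
  startY : Fin N → ℝ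

namespace BeamSchedule

variable {N : ℕ} (B : BeamSchedule N)

/-- The final time `T = t_N`. -/
def endTime : ℝ := B.time (Fin.last N)

/-- The initial time of segment `n`. -/
def ti (n : Fin N) : ℝ := B.time n.castSucc

/-- The final time of segment `n`. -/
def tf (n : Fin N) : ℝ := B.time n.succ

/-- The time interval of segment `n`, `(t_n^i, t_n^f]`. -/
def segment (n : Fin N) : Set ℝ := Ioc (B.ti n) (B.tf n)

/-- The `x`-component of the beam velocity on segment `n`. -/
def vx (n : Fin N) : ℝ := B.speed n * Real.cos (B.angle n)

/-- The `y`-component of the beam velocity on segment `n`. -/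
def vy (n : Fin N) : ℝ := B.speed n * Real.sin (B.angle n)

/-- The `x`-coordinate of the final position of segment `n`. -/
def finalX (n : Fin N) : ℝ := B.startX n + B.vx n * (B.tf n - B.ti n)

/-- The `y`-coordinate of the final position of segment `n`. -/
def finalY (n : Fin N) : ℝ := B.startY n + B.vy n * (B.tf n - B.ti n)

/-- The function of time that equals `f n` on segment `n`, for each `n` (and `0` off the segments). -/
def piecewise (f : Fin N → ℝ → ℝ) (t : ℝ) : ℝ := ∑ n, (B.segment n).indicator (f n) t

theorem piecewise_eq (f : Fin N → ℝ → ℝ) (n : Fin N) {t : ℝ} (ht : t ∈ B.segment n) :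
    B.piecewise f t = f n t := by
  unfold piecewise
  rw [Finset.sum_eq_single n, indicator_of_mem ht]
  · intro k _ hk
    refine indicator_of_notMem (fun h => ?_) _
    rcases lt_or_gt_of_ne hk with h' | h'
    · have h1 : B.tf k ≤ B.ti n := B.time_strictMono.monotone (Fin.succ_le_castSucc_iff.2 h')
      exact absurd ht.1 (not_lt.2 (h.2.trans h1))
    · have h1 : B.tf n ≤ B.ti k := B.time_strictMono.monotone (Fin.succ_le_castSucc_iff.2 h')
      exact absurd h.1 (not_lt.2 (ht.2.trans h1))
  · intro h
    exact absurd (Finset.mem_univ n) h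

/-- The beam power `P(t)`. -/
def powerAt : ℝ → ℝ := B.piecewise fun n _ => B.power n

/-- The beam spot size `σ(t)`. -/
def spotAt : ℝ → ℝ := B.piecewise fun n _ => B.spot n

/-- The `x`-coordinate of the beam center at time `t`. -/
def centerX : ℝ → ℝ := B.piecewise fun n t => B.startX n + B.vx n * (t - B.ti n)

/-- The `y`-coordinate of the beam center at time `t`. -/
def centerY : ℝ → ℝ := B.piecewise fun n t => B.startY n + B.vy n * (t - B.ti n)

/-- The moving Gaussian surface flux `Φ(x, y, t)`. -/
def flux (x y t : ℝ) : ℝ :=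
  B.powerAt t / (2 * Real.pi * B.spotAt t ^ 2) *
    Real.exp (-(((x - B.centerX t) ^ 2 + (y - B.centerY t) ^ 2) / (2 * B.spotAt t ^ 2)))

end BeamSchedule

/-- `u` is a bounded classical solution, for times in `[0, T]`, of the heat equation
`ρ c_p ∂u/∂t - λ Δu = 0` in the half-space `z < 0`, with surface flux `λ ∂u/∂z = Φ` on `z = 0` and
the constant initial temperature `uInit`. Only the values of `u` for `z ≤ 0` and `0 ≤ t ≤ T` matter;
at `t = T` the time derivative is the one from the left. -/
structure IsBoundedSolution (m : Material) (flux : ℝ → ℝ → ℝ → ℝ) (T uInit : ℝ)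
    (u : Space → ℝ → ℝ) : Prop where
  continuousOn : ContinuousOn (fun p : Space × ℝ => u p.1 p.2) ({x : Space | x 2 ≤ 0} ×ˢ Icc 0 T)
  bounded : ∃ M : ℝ, ∀ x : Space, x 2 ≤ 0 → ∀ t ∈ Icc 0 T, |u x t| ≤ M
  contDiffAt : ∀ x : Space, x 2 < 0 → ∀ t ∈ Ioc 0 T, ContDiffAt ℝ 2 (fun y => u y t) x
  differentiable_time : ∀ x : Space, x 2 < 0 → ∀ t ∈ Ioc 0 T,
    DifferentiableWithinAt ℝ (u x) (Icc 0 T) t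
  heat_equation : ∀ x : Space, x 2 < 0 → ∀ t ∈ Ioc 0 T,
    m.density * m.heatCapacity * derivWithin (u x) (Icc 0 T) t
      - m.conductivity * (Δ (fun y => u y t)) x = 0
  surface_flux : ∀ x : Space, x 2 = 0 → ∀ t ∈ Ioc 0 T, ∃ d : ℝ,
    HasDerivWithinAt (fun h : ℝ => u (x + h • EuclideanSpace.single 2 1) t) d (Iic 0) 0 ∧
      m.conductivity * d = flux (x 0) (x 1) t
  initial : ∀ x : Space, x 2 < 0 → u x 0 = uInit

/-- The Green's function `G(x, t)` of three-dimensional diffusion with diffusivity `κ`. -/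
def green (κ : ℝ) (x : Space) (t : ℝ) : ℝ :=
  (1 / (4 * Real.pi * κ * t)) ^ (3 / 2 : ℝ) * Real.exp (-(‖x‖ ^ 2 / (4 * κ * t)))

/-- The convolution `G(·, t) * f` over `ℝ³`. -/
def diffuse (κ t : ℝ) (f : Space → ℝ) : Space → ℝ := (fun x => green κ x t) ⋆ f

/-- The extension of a function on the half-space `z ≤ 0` to `ℝ³` that is even in `z`. -/
def evenExtension (f : Space → ℝ) (x : Space) : ℝ := f !₂[x 0, x 1, -|x 2|]

/-- The Gaussian integral over one of the two horizontal coordinates. -/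
def lateralIntegral (v x t r : ℝ) : ℝ :=
  ∫ ξ : ℝ, Real.exp (-((x - ξ) ^ 2 / t ^ 2) - (ξ + v * r ^ 2) ^ 2 / (1 + r ^ 2))

/-- The Gaussian integral over the vertical coordinate. -/
def verticalIntegral (z t r : ℝ) : ℝ :=
  ∫ ζ : ℝ, Real.exp (-((z - ζ) ^ 2 / t ^ 2) - ζ ^ 2 / r ^ 2)

namespace BeamSchedule

variable {N : ℕ} (B : BeamSchedule N) (m : Material)

/-- The flux term `u_n^Φ`: the half-space temperature due to the surface flux `Φ` during segment `n`
up to the time `t`. -/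
def fluxTerm (n : Fin N) (x : Space) (t : ℝ) : ℝ :=
  2 / (m.density * m.heatCapacity) * ∫ s in B.ti n..t, ∫ p : ℝ × ℝ,
    green m.diffusivity !₂[x 0 - p.1, x 1 - p.2, x 2] (t - s) * B.flux p.1 p.2 s

/-- The initial value term `u_n^I` of the temperature `u`: the temperature at the initial time of
segment `n`, diffused without surface flux up to the time `t`. -/
def initialTerm (u : Space → ℝ → ℝ) (n : Fin N) (x : Space) (t : ℝ) : ℝ :=
  diffuse m.diffusivity (t - B.ti n) (evenExtension fun ξ => u ξ (B.ti n)) x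

/-- The contribution `u_{n,k}^I` of the earlier segment `k` to the initial value term. -/
def contribution (k : Fin N) (x : Space) (t : ℝ) : ℝ :=
  diffuse m.diffusivity (t - B.tf k) (fun ξ => B.fluxTerm m k ξ (B.tf k)) x

/-- The temperature scale `T_n`. -/
def tempScale (n : Fin N) : ℝ :=
  B.power n / (√2 * Real.pi ^ (3 / 2 : ℝ) * m.conductivity * B.spot n)

/-- The dimensionless velocity component in direction `x`. -/
def vxBar (n : Fin N) : ℝ := B.vx n * B.spot n / (2 * √2 * m.diffusivity)

/-- The dimensionless velocity component in direction `y`. -/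
def vyBar (n : Fin N) : ℝ := B.vy n * B.spot n / (2 * √2 * m.diffusivity)

/-- The dimensionless form of a duration `τ` with respect to the spot size of segment `n`. -/
def timeBar (n : Fin N) (τ : ℝ) : ℝ := √(2 * m.diffusivity * τ) / B.spot n

/-- The dimensionless form of a length `l` with respect to the spot size of segment `n`. -/
def lengthBar (n : Fin N) (l : ℝ) : ℝ := l / (√2 * B.spot n)

/-- The dimensionless one-dimensional integral for the flux term of segment `n`. -/
def fluxFormula (n : Fin N) (x : Space) (t : ℝ) : ℝ :=
  let X := B.lengthBar n (x 0 - B.startX n - B.vx n * (t - B.ti n))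
  let Y := B.lengthBar n (x 1 - B.startY n - B.vy n * (t - B.ti n))
  let Z := B.lengthBar n (x 2)
  B.tempScale m n * ∫ s in (0 : ℝ)..B.timeBar m n (t - B.ti n),
    1 / (1 + s ^ 2) *
      Real.exp (-(((X + B.vxBar m n * s ^ 2) ^ 2 + (Y + B.vyBar m n * s ^ 2) ^ 2) / (1 + s ^ 2))
        - Z ^ 2 / s ^ 2)

/-- The contribution of segment `k`, through the three Gaussian integrals over space. -/
def contributionIntegral (k : Fin N) (x : Space) (t : ℝ) : ℝ :=
  let X := B.lengthBar k (x 0 - B.finalX k)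
  let Y := B.lengthBar k (x 1 - B.finalY k)
  let Z := B.lengthBar k (x 2)
  let τ := B.timeBar m k (t - B.tf k)
  B.tempScale m k / (Real.pi ^ (3 / 2 : ℝ) * τ ^ 3) *
    ∫ r in (0 : ℝ)..B.timeBar m k (B.tf k - B.ti k),
      1 / (1 + r ^ 2) * lateralIntegral (B.vxBar m k) X τ r * lateralIntegral (B.vyBar m k) Y τ r *
        verticalIntegral Z τ r

/-- The dimensionless one-dimensional integral for the contribution of segment `k`. -/
def contributionFormula (k : Fin N) (x : Space) (t : ℝ) : ℝ :=
  let X := B.lengthBar k (x 0 - B.finalX k)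
  let Y := B.lengthBar k (x 1 - B.finalY k)
  let Z := B.lengthBar k (x 2)
  let τ := B.timeBar m k (t - B.tf k)
  B.tempScale m k * ∫ r in (0 : ℝ)..B.timeBar m k (B.tf k - B.ti k),
    r * (r ^ 2 + τ ^ 2) ^ (-(1 / 2) : ℝ) / (1 + r ^ 2 + τ ^ 2) *
      Real.exp (-(((X + B.vxBar m k * r ^ 2) ^ 2 + (Y + B.vyBar m k * r ^ 2) ^ 2)
        / (1 + r ^ 2 + τ ^ 2)) - Z ^ 2 / (r ^ 2 + τ ^ 2))

end BeamSchedule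

end BeamHeat

end

/-!
The problem is linear, and a solution is built by superposition. The basic object is
`BeamSchedule.potential`: the temperature rise caused by the beam of one segment, continued along
its straight line forever and switched on at a time `a`. Once the integrals over the surface have
been carried out, it is a constant times `kernelIntegral V W X Y Z R = ∫ r in 0..R, kernel ...`,
where the dimensionless `X`, `Y`, `Z` are affine in `x` and `t`, and `R` is proportional to
`√(t - a)`; the square root vanishes for `t ≤ a`, so that this formula covers all times. The
temperature rise caused by the segment itself is a difference of two potentials, `rise`: one beam is
switched on at the start, and its continuation is switched off at the end of the segment.

* The potential solves the problem (`isBoundedSolution_potential`). For `Z ≠ 0` the factor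
  `exp (-Z² / r²)` extends smoothly to `r = 0` (`flat`), so that one may differentiate under the
  integral, and the heat equation follows from the pointwise identity
  `ΔK + 4 V K_X + 4 W K_Y = 2 ∂ᵣ (K / r)` for the kernel `K` (`kernelIntegral_heat`). At the surface,
  the substitution `r = |Z| w` and dominated convergence give the normal derivative
  (`hasDerivWithinAt_kernelIntegral_surface`).
* Bounded solutions with the same data agree (`IsBoundedSolution.eq_of_same_data`): this is the
  maximum principle, with a quadratic barrier that handles the unbounded domain and whose positive
  normal derivative excludes a maximum on the surface.
* The Green's function convolved with the kernel is a product of three Gaussian integrals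
  (`integral_green_mul_kernel`), and amounts to the shift `r² ↦ r² + τ²` of the integration variable
  (`integral_diffusedKernel`). Therefore the temperature rise due to a finished segment evolves by
  free diffusion (`diffuse_rise`), which identifies both the contributions of the earlier segments
  and the initial value term; the evenness of the rise in `z` takes care of the even extension.
* The flux term takes its dimensionless form by the substitution `t - s = σ² r² / (2 κ)`
  (`fluxTerm_eq_fluxFormula`).
-/

namespace BeamHeat

open Filter Topology

/-! ### Derivative tests -/

/-- The second derivative along the line `h ↦ x + h v` is the Hessian at `(v, v)`. -/
theorem deriv_deriv_line {E : Type*} [NormedAddCommGroup E] [NormedSpace ℝ E] {f : E → ℝ} {x : E}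
    (hf : ContDiffAt ℝ 2 f x) (v : E) :
    deriv (deriv fun h : ℝ => f (x + h • v)) 0 = fderiv ℝ (fderiv ℝ f) x v v := by
  have hline : ∀ h : ℝ, HasDerivAt (fun h : ℝ => x + h • v) v h := fun h => by
    simpa using ((hasDerivAt_id h).smul_const v).const_add x
  have hd : ∀ᶠ y in 𝓝 x, DifferentiableAt ℝ f y :=
    (hf.eventually (by simp)).mono fun y hy => hy.differentiableAt (by simp)
  have hcont : Tendsto (fun h : ℝ => x + h • v) (𝓝 0) (𝓝 x) := by
    simpa using (hline 0).continuousAt.tendsto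
  have h1 : (deriv fun h : ℝ => f (x + h • v)) =ᶠ[𝓝 0] fun h => fderiv ℝ f (x + h • v) v := by
    filter_upwards [hcont.eventually hd] with h hh
    exact (hh.hasFDerivAt.comp_hasDerivAt h (hline h)).deriv
  rw [h1.deriv_eq]
  have h2 : HasFDerivAt (fderiv ℝ f) (fderiv ℝ (fderiv ℝ f) x) (x + (0 : ℝ) • v) := by
    have h3 : ContDiffAt ℝ 1 (fderiv ℝ f) x := hf.fderiv_right (by norm_num)
    simpa using (h3.differentiableAt (by simp)).hasFDerivAt
  have h4 := h2.comp_hasDerivAt (0 : ℝ) (hline 0)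
  exact (h4.clm_apply (hasDerivAt_const (0 : ℝ) v)).deriv.trans (by simp)

theorem laplacian_eq_sum_deriv_deriv {f : Space → ℝ} {x : Space} (hf : ContDiffAt ℝ 2 f x) :
    (Δ f) x = ∑ i : Fin 3,
      deriv (deriv fun h : ℝ => f (x + h • EuclideanSpace.single i (1 : ℝ))) 0 := by
  rw [InnerProductSpace.laplacian_eq_iteratedFDeriv_orthonormalBasis f
    (EuclideanSpace.basisFun (Fin 3) ℝ)]
  simp only [iteratedFDeriv_two_apply, deriv_deriv_line hf]
  simp

theorem deriv_deriv_nonpos_of_isLocalMax {g : ℝ → ℝ} (hc : ContinuousAt g 0)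
    (hm : IsLocalMax g 0) : deriv (deriv g) 0 ≤ 0 := by
  by_contra! h
  have hmin := isLocalMin_of_deriv_deriv_pos h hm.deriv_eq_zero hc
  have hconst : g =ᶠ[𝓝 0] fun _ => g 0 := by
    filter_upwards [hm, hmin] with y h1 h2 using le_antisymm h1 h2
  have h0 : deriv (deriv g) 0 = 0 := by
    rw [hconst.deriv.deriv_eq]; simp
  exact h.ne' h0

/-- If `g` stays below a parabola `g 0 + a h + b h²` near `0`, its second derivative at `0` is at
most `2 b`. -/
theorem deriv_deriv_le_of_le_parabola {g : ℝ → ℝ} {a b : ℝ} (hg : ContDiffAt ℝ 2 g 0)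
    (h : ∀ᶠ y in 𝓝 0, g y ≤ g 0 + a * y + b * y ^ 2) : deriv (deriv g) 0 ≤ 2 * b := by
  have hd : ∀ᶠ y in 𝓝 (0 : ℝ), DifferentiableAt ℝ g y :=
    (hg.eventually (by simp)).mono fun y hy => hy.differentiableAt (by simp)
  have hp : ∀ y : ℝ, HasDerivAt (fun y => a * y + b * y ^ 2) (a + 2 * b * y) y := fun y => by
    have := ((hasDerivAt_id y).const_mul a).add ((hasDerivAt_pow 2 y).const_mul b)
    refine this.congr_deriv ?_
    push_cast; ring
  have h1 : deriv (fun y => g y - (a * y + b * y ^ 2)) =ᶠ[𝓝 0]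
      fun y => deriv g y - (a + 2 * b * y) := by
    filter_upwards [hd] with y hy
    exact (hy.hasDerivAt.sub (hp y)).deriv
  have h2 : DifferentiableAt ℝ (deriv g) 0 := by
    have : ContDiffAt ℝ 1 (deriv g) 0 := by
      have h3 : ContDiffAt ℝ 1 (fderiv ℝ g) 0 := hg.fderiv_right (by norm_num)
      exact h3.clm_apply contDiffAt_const
    exact this.differentiableAt (by simp)
  have h3 : deriv (deriv fun y => g y - (a * y + b * y ^ 2)) 0 = deriv (deriv g) 0 - 2 * b := by
    rw [h1.deriv_eq]
    have h5 : HasDerivAt (fun y : ℝ => a + 2 * b * y) (2 * b) 0 := by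
      simpa using ((hasDerivAt_id (0 : ℝ)).const_mul (2 * b)).const_add a
    exact (h2.hasDerivAt.sub h5).deriv
  have h4 := deriv_deriv_nonpos_of_isLocalMax (g := fun y => g y - (a * y + b * y ^ 2))
    (hg.continuousAt.sub (hp 0).continuousAt) (by
      filter_upwards [h] with y hy
      simp only [mul_zero, ne_eq, OfNat.ofNat_ne_zero, not_false_eq_true, zero_pow, add_zero,
        sub_zero]
      linarith)
  linarith

theorem nonneg_of_hasDerivWithinAt_of_le_right {f : ℝ → ℝ} {a b d : ℝ} (hab : a < b)
    (hf : HasDerivWithinAt f d (Icc a b) b) (h : ∀ y ∈ Icc a b, f y ≤ f b) : 0 ≤ d := by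
  have hm : IsLocalMaxOn f (Icc a b) b := eventually_nhdsWithin_of_forall h
  have h1 := hm.hasFDerivWithinAt_nonpos hf.hasFDerivWithinAt
    (sub_mem_posTangentConeAt_of_segment_subset (x := b) (y := a)
      (by rw [segment_symm, segment_eq_Icc hab.le]))
  simp at h1
  nlinarith

/-! ### Linearity and uniqueness of bounded solutions -/

theorem isClosed_halfSpace : IsClosed {x : Space | x 2 ≤ 0} :=
  isClosed_le (by fun_prop) continuous_const

namespace IsBoundedSolution

variable {m : Material} {f g : ℝ → ℝ → ℝ → ℝ} {T a b : ℝ} {u v : Space → ℝ → ℝ}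

theorem uniqueDiffWithinAt {t : ℝ} (ht : t ∈ Ioc 0 T) : UniqueDiffWithinAt ℝ (Icc 0 T) t :=
  uniqueDiffOn_Icc (ht.1.trans_le ht.2) t ⟨ht.1.le, ht.2⟩

theorem const (m : Material) (T a : ℝ) :
    IsBoundedSolution m (fun _ _ _ => 0) T a (fun _ _ => a) where
  continuousOn := continuousOn_const
  bounded := ⟨|a|, fun _ _ _ _ => le_rfl⟩
  contDiffAt _ _ _ _ := contDiffAt_const
  differentiable_time _ _ _ _ := differentiableWithinAt_const _
  heat_equation _ _ _ _ := by
    simp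
  surface_flux _ _ _ _ := ⟨0, hasDerivWithinAt_const _ _ _, by simp⟩
  initial _ _ := rfl

theorem add (hu : IsBoundedSolution m f T a u) (hv : IsBoundedSolution m g T b v) :
    IsBoundedSolution m (fun x y t => f x y t + g x y t) T (a + b) (fun x t => u x t + v x t) where
  continuousOn := hu.continuousOn.add hv.continuousOn
  bounded := by
    obtain ⟨M, hM⟩ := hu.bounded
    obtain ⟨M', hM'⟩ := hv.bounded
    exact ⟨M + M', fun x hx t ht => (abs_add_le _ _).trans
      (add_le_add (hM x hx t ht) (hM' x hx t ht))⟩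
  contDiffAt x hx t ht := (hu.contDiffAt x hx t ht).add (hv.contDiffAt x hx t ht)
  differentiable_time x hx t ht :=
    (hu.differentiable_time x hx t ht).add (hv.differentiable_time x hx t ht)
  heat_equation x hx t ht := by
    have h1 := hu.heat_equation x hx t ht
    have h2 := hv.heat_equation x hx t ht
    have h3 := (hu.contDiffAt x hx t ht).laplacian_add (hv.contDiffAt x hx t ht)
    have h4 : derivWithin (fun t => u x t + v x t) (Icc 0 T) t = _ :=
      derivWithin_add (hu.differentiable_time x hx t ht) (hv.differentiable_time x hx t ht)
    change _ * derivWithin (fun t => u x t + v x t) (Icc 0 T) t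
      - _ * (Δ ((fun y => u y t) + fun y => v y t)) x = 0
    rw [h3, h4]
    linarith
  surface_flux x hx t ht := by
    obtain ⟨d, hd, hd'⟩ := hu.surface_flux x hx t ht
    obtain ⟨e, he, he'⟩ := hv.surface_flux x hx t ht
    exact ⟨d + e, hd.add he, by rw [mul_add, hd', he']⟩
  initial x hx := by rw [hu.initial x hx, hv.initial x hx]

theorem const_mul (c : ℝ) (hu : IsBoundedSolution m f T a u) :
    IsBoundedSolution m (fun x y t => c * f x y t) T (c * a) (fun x t => c * u x t) where
  continuousOn := continuousOn_const.mul hu.continuousOn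
  bounded := by
    obtain ⟨M, hM⟩ := hu.bounded
    exact ⟨|c| * M, fun x hx t ht => by
      rw [abs_mul]; exact mul_le_mul_of_nonneg_left (hM x hx t ht) (abs_nonneg c)⟩
  contDiffAt x hx t ht := contDiffAt_const.mul (hu.contDiffAt x hx t ht)
  differentiable_time x hx t ht := (hu.differentiable_time x hx t ht).const_mul c
  heat_equation x hx t ht := by
    have h1 := hu.heat_equation x hx t ht
    have h3 := InnerProductSpace.laplacian_smul c (hu.contDiffAt x hx t ht)
    have h4 : derivWithin (fun t => c * u x t) (Icc 0 T) t = _ :=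
      derivWithin_const_mul c (hu.differentiable_time x hx t ht)
    change _ * derivWithin (fun t => c * u x t) (Icc 0 T) t
      - _ * (Δ (c • (fun y => u y t))) x = 0
    rw [h3, h4, smul_eq_mul]
    linear_combination c * h1
  surface_flux x hx t ht := by
    obtain ⟨d, hd, hd'⟩ := hu.surface_flux x hx t ht
    exact ⟨c * d, hd.const_mul c, by rw [← hd']; ring⟩
  initial x hx := by rw [hu.initial x hx]

theorem sub (hu : IsBoundedSolution m f T a u) (hv : IsBoundedSolution m g T b v) :
    IsBoundedSolution m (fun x y t => f x y t - g x y t) T (a - b) (fun x t => u x t - v x t) := by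
  simpa [sub_eq_add_neg] using hu.add (hv.const_mul (-1))

theorem sum {ι : Type*} (s : Finset ι) {f : ι → ℝ → ℝ → ℝ → ℝ} {u : ι → Space → ℝ → ℝ}
    (h : ∀ i ∈ s, IsBoundedSolution m (f i) T 0 (u i)) :
    IsBoundedSolution m (fun x y t => ∑ i ∈ s, f i x y t) T 0 (fun x t => ∑ i ∈ s, u i x t) := by
  classical
  induction s using Finset.induction_on with
  | empty => simpa using const m T 0
  | insert i s hi ih =>
    have h1 := (h i (by simp)).add (ih fun j hj => h j (by simp [hj]))
    simpa [Finset.sum_insert hi] using h1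

/-- The initial value is attained up to the surface `z = 0`, by continuity. -/
theorem initial_of_nonpos (hT : 0 ≤ T) (hu : IsBoundedSolution m f T a u) {x : Space}
    (hx : x 2 ≤ 0) : u x 0 = a := by
  have h0 : (0 : ℝ) ∈ Icc 0 T := ⟨le_rfl, hT⟩
  have hc : ContinuousWithinAt (fun y : Space => u y 0) {y : Space | y 2 ≤ 0} x := by
    have := hu.continuousOn (x, 0) ⟨hx, h0⟩
    exact this.comp (f := fun y : Space => (y, (0 : ℝ))) (by fun_prop) fun y hy => ⟨hy, h0⟩
  have hcl : x ∈ closure {y : Space | y 2 < 0} := by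
    have ht : Tendsto (fun h : ℝ => x + h • EuclideanSpace.single (2 : Fin 3) (1 : ℝ)) (𝓝[<] 0)
        (𝓝 x) := by
      have : Continuous fun h : ℝ => x + h • EuclideanSpace.single (2 : Fin 3) (1 : ℝ) := by
        fun_prop
      simpa using (this.tendsto 0).mono_left nhdsWithin_le_nhds
    refine mem_closure_of_tendsto ht ?_
    filter_upwards [self_mem_nhdsWithin] with h hh
    simp at hh ⊢
    linarith
  have hc' := hc.mono (s := {y : Space | y 2 < 0}) fun y (hy : y 2 < 0) => hy.le
  have : (𝓝[{y : Space | y 2 < 0}] x).NeBot := mem_closure_iff_nhdsWithin_neBot.1 hcl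
  refine tendsto_nhds_unique hc' ((tendsto_congr' ?_).2 tendsto_const_nhds)
  filter_upwards [self_mem_nhdsWithin] with y hy using hu.initial y hy

/-- The maximum principle: comparison with the barrier `ε (|x|² + z + (6 κ + 1) t + 1)`, which is
bounded below, tends to infinity, is a strict supersolution, and has a positive normal derivative
at the surface, so that `u` minus the barrier has no positive maximum. -/
theorem nonpos_of_zero_data (hu : IsBoundedSolution m (fun _ _ _ => 0) T 0 u) {x : Space}
    (hx : x 2 ≤ 0) {t : ℝ} (ht : t ∈ Icc 0 T) : u x t ≤ 0 := by
  have hT : 0 ≤ T := ht.1.trans ht.2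
  set κ := m.conductivity / (m.density * m.heatCapacity) with hκ
  have hρ : 0 < m.density * m.heatCapacity := mul_pos m.density_pos m.heatCapacity_pos
  have hκ0 : 0 < κ := div_pos m.conductivity_pos hρ
  have hκ1 : m.density * m.heatCapacity * κ = m.conductivity := by
    rw [hκ, mul_div_cancel₀ _ hρ.ne']
  set b : Space → ℝ → ℝ := fun x t => ‖x‖ ^ 2 + x 2 + (6 * κ + 1) * t + 1 with hb
  have hz : ∀ x : Space, ‖x‖ ^ 2 = x 0 ^ 2 + x 1 ^ 2 + x 2 ^ 2 := fun x => by
    rw [EuclideanSpace.norm_sq_eq, Fin.sum_univ_three]; simp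
  have hbnn : ∀ x : Space, ∀ t, 0 ≤ t → ‖x‖ ^ 2 / 2 ≤ b x t := fun x t h => by
    have : 0 ≤ (6 * κ + 1) * t := by positivity
    simp only [hb]
    rw [hz x]
    nlinarith [sq_nonneg (x 2 + 1), sq_nonneg (x 0), sq_nonneg (x 1)]
  obtain ⟨M, hM⟩ := hu.bounded
  have hbcont : Continuous fun p : Space × ℝ => b p.1 p.2 := by
    simp only [hb]; fun_prop
  -- It is enough to prove the bound for every barrier, as `ε → 0`.
  suffices key : ∀ ε > 0, ∀ x : Space, x 2 ≤ 0 → ∀ t ∈ Icc 0 T, u x t - ε * b x t ≤ 0 by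
    have h1 : Tendsto (fun ε : ℝ => u x t - ε * b x t) (𝓝[>] 0) (𝓝 (u x t - 0 * b x t)) := by
      have : Continuous fun ε : ℝ => u x t - ε * b x t := by fun_prop
      exact (this.tendsto 0).mono_left nhdsWithin_le_nhds
    have h2 := le_of_tendsto h1 (by
      filter_upwards [self_mem_nhdsWithin] with ε hε using key ε hε x hx t ht)
    simpa using h2
  intro ε hε x₁ hx₁ t₁ ht₁
  by_contra! hpos
  set S : Set (Space × ℝ) := {x : Space | x 2 ≤ 0} ×ˢ Icc 0 T
  have hS : IsClosed S := isClosed_halfSpace.prod isClosed_Icc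
  have hψ : ContinuousOn (fun p : Space × ℝ => u p.1 p.2 - ε * b p.1 p.2) S :=
    hu.continuousOn.sub (hbcont.const_smul ε).continuousOn
  -- Outside the ball of radius `1 + 2 M / ε`, the barrier exceeds the bound `M` on `u`.
  have hcoc : ∀ᶠ p in cocompact (Space × ℝ) ⊓ 𝓟 S,
      u p.1 p.2 - ε * b p.1 p.2 ≤ u x₁ t₁ - ε * b x₁ t₁ := by
    rw [eventually_inf_principal]
    refine mem_cocompact.2 ⟨Metric.closedBall 0 (1 + 2 * M / ε) ×ˢ Icc 0 T,
      (isCompact_closedBall _ _).prod isCompact_Icc, ?_⟩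
    rintro ⟨y, s⟩ hys ⟨hy, hs⟩
    have hy' : 1 + 2 * M / ε < ‖y‖ := by
      by_contra! h
      exact hys ⟨by simpa using h, hs⟩
    have hM0 : 0 ≤ M := (abs_nonneg _).trans (hM y hy s hs)
    have h1 : 2 * M / ε ≤ ‖y‖ ^ 2 := by
      have : 0 ≤ 2 * M / ε := by positivity
      nlinarith
    rw [div_le_iff₀ hε] at h1
    have h2 := (le_abs_self _).trans (hM y hy s hs)
    have h3 := mul_le_mul_of_nonneg_left (hbnn y s hs.1) hε.le
    change u y s - ε * b y s ≤ _
    nlinarith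
  obtain ⟨⟨y, s⟩, ⟨hy, hs⟩, hmax⟩ := hψ.exists_isMaxOn' hS (x₀ := (x₁, t₁)) ⟨hx₁, ht₁⟩ hcoc
  have hmax' : ∀ x' : Space, x' 2 ≤ 0 → ∀ t' ∈ Icc 0 T,
      u x' t' - ε * b x' t' ≤ u y s - ε * b y s := fun x' h1 t' h2 =>
    hmax (a := (x', t')) ⟨h1, h2⟩
  have hys : 0 < u y s - ε * b y s := hpos.trans_le (hmax' x₁ hx₁ t₁ ht₁)
  change y 2 ≤ 0 at hy
  change s ∈ Icc 0 T at hs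
  have hs0 : 0 < s := by
    rcases hs.1.eq_or_lt with h | h
    · rw [← h, hu.initial_of_nonpos hT hy] at hys
      have h3 := mul_le_mul_of_nonneg_left (hbnn y 0 le_rfl) hε.le
      nlinarith [sq_nonneg ‖y‖]
    · exact h
  have hline : ∀ i : Fin 3, ∀ h : ℝ, b (y + h • EuclideanSpace.single i (1 : ℝ)) s
      = b y s + (2 * y i + if i = 2 then 1 else 0) * h + 1 * h ^ 2 := fun i h => by
    simp only [hb, hz]
    fin_cases i <;> simp <;> ring
  -- A maximum at the surface contradicts the normal derivative `-ε`, and one inside contradicts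
  -- the differential inequality; at `t = T` only the derivative from the left is used.
  rcases hy.eq_or_lt with hy0 | hy0
  · obtain ⟨d, hd, hd'⟩ := hu.surface_flux y hy0 s ⟨hs0, hs.2⟩
    have hd0 : d = 0 := by
      simpa [m.conductivity_pos.ne'] using hd'
    have h1 : HasDerivWithinAt (fun h : ℝ => u (y + h • EuclideanSpace.single 2 (1 : ℝ)) s
        - ε * (b y s + (2 * y 2 + 1) * h + 1 * h ^ 2)) (d - ε * (2 * y 2 + 1)) (Icc (-1) 0) 0 := by
      refine (hd.mono Icc_subset_Iic_self).sub (HasDerivAt.hasDerivWithinAt ?_)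
      refine HasDerivAt.const_mul ε ?_
      have := (((hasDerivAt_id (0 : ℝ)).const_mul (2 * y 2 + 1)).const_add (b y s)).add
        ((hasDerivAt_pow 2 (0 : ℝ)).const_mul 1)
      exact this.congr_deriv (by simp)
    have h2 := nonneg_of_hasDerivWithinAt_of_le_right (by norm_num) h1 fun h hh => by
      have h3 := hmax' (y + h • EuclideanSpace.single 2 (1 : ℝ)) (by simp; linarith [hh.2]) s hs
      rw [hline 2 h] at h3
      simpa using h3
    rw [hd0, hy0] at h2
    linarith
  · have hcd := hu.contDiffAt y hy0 s ⟨hs0, hs.2⟩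
    have hlap : (Δ fun y => u y s) y ≤ ∑ _i : Fin 3, 2 * ε := by
      rw [laplacian_eq_sum_deriv_deriv hcd]
      refine Finset.sum_le_sum fun i _ => ?_
      have hlc : Continuous fun h : ℝ => y + h • EuclideanSpace.single i (1 : ℝ) := by fun_prop
      refine deriv_deriv_le_of_le_parabola (a := ε * (2 * y i + if i = 2 then 1 else 0)) ?_ ?_
      · refine ContDiffAt.comp (g := fun y => u y s) (0 : ℝ) (by simpa using hcd) ?_
        fun_prop
      · have hev : ∀ᶠ h in 𝓝 (0 : ℝ), (y + h • EuclideanSpace.single i (1 : ℝ)) 2 < 0 := by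
          have : Continuous fun h : ℝ => (y + h • EuclideanSpace.single i (1 : ℝ)) 2 := by
            fun_prop
          exact (this.tendsto 0).eventually_lt_const (by simpa using hy0)
        filter_upwards [hev] with h hh
        have h3 := hmax' _ hh.le s hs
        rw [hline i h] at h3
        simp only [zero_smul, add_zero]
        linarith
    have htime : ε * (6 * κ + 1) ≤ derivWithin (u y) (Icc 0 T) s := by
      have h1 := ((hu.differentiable_time y hy0 s ⟨hs0, hs.2⟩).hasDerivWithinAt.mono
        (Icc_subset_Icc_right hs.2)).sub
        ((((hasDerivAt_id s).const_mul (6 * κ + 1)).const_mul ε).hasDerivWithinAt (s := Icc 0 s))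
      have h2 := nonneg_of_hasDerivWithinAt_of_le_right hs0 h1 fun r hr => by
        have h3 := hmax' y hy r ⟨hr.1, hr.2.trans hs.2⟩
        simp only [hb] at h3
        simp only [Pi.sub_apply, id]
        linarith
      simp only [mul_one] at h2
      linarith
    have heq := hu.heat_equation y hy0 s ⟨hs0, hs.2⟩
    simp only [Finset.sum_const, Finset.card_univ, Fintype.card_fin, nsmul_eq_mul,
      Nat.cast_ofNat] at hlap
    have h1 := mul_le_mul_of_nonneg_left htime hρ.le
    have h2 := mul_le_mul_of_nonneg_left hlap m.conductivity_pos.le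
    have h3 := mul_pos hρ hε
    have h4 : m.density * m.heatCapacity * (ε * (6 * κ + 1))
        = 6 * ε * m.conductivity + m.density * m.heatCapacity * ε := by
      linear_combination 6 * ε * hκ1
    linarith

theorem eq_of_same_data (hu : IsBoundedSolution m f T a u) (hv : IsBoundedSolution m f T a v)
    {x : Space} (hx : x 2 ≤ 0) {t : ℝ} (ht : t ∈ Icc 0 T) : u x t = v x t := by
  have h1 := hu.sub hv
  have h2 := hv.sub hu
  simp only [sub_self] at h1 h2
  have h3 := h1.nonpos_of_zero_data hx ht
  have h4 := h2.nonpos_of_zero_data hx ht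
  linarith

end IsBoundedSolution

/-! ### Integrals depending smoothly on a parameter -/

theorem exists_ball_bound {E F : Type*} [NormedAddCommGroup E] [ProperSpace E]
    [NormedAddCommGroup F] {h : E → ℝ → F} {s : Set E} (hs : IsOpen s)
    (hh : ContinuousOn (fun p : E × ℝ => h p.1 p.2) (s ×ˢ univ)) {x : E} (hx : x ∈ s) (a b : ℝ) :
    ∃ ε > 0, Metric.ball x ε ⊆ s ∧ ∃ C, ∀ r ∈ uIoc a b, ∀ y ∈ Metric.ball x ε, ‖h y r‖ ≤ C := by
  obtain ⟨ε, hε, hsub⟩ := Metric.nhds_basis_closedBall.mem_iff.1 (hs.mem_nhds hx)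
  have hcomp : IsCompact (Metric.closedBall x ε ×ˢ uIcc a b) :=
    (isCompact_closedBall x ε).prod isCompact_uIcc
  obtain ⟨C, hC⟩ := hcomp.exists_bound_of_continuousOn
    (hh.mono (prod_mono hsub (subset_univ _)))
  exact ⟨ε, hε, Metric.ball_subset_closedBall.trans hsub, C, fun r hr y hy =>
    hC (y, r) ⟨Metric.ball_subset_closedBall hy, uIoc_subset_uIcc hr⟩⟩

theorem hasFDerivAt_intervalIntegral_param {E F : Type*} [NormedAddCommGroup E] [NormedSpace ℝ E]
    [ProperSpace E] [NormedAddCommGroup F] [NormedSpace ℝ F] {g : E → ℝ → F}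
    {g' : E → ℝ → E →L[ℝ] F} {s : Set E} (hs : IsOpen s)
    (hg : ∀ x ∈ s, Continuous (g x)) (hd : ∀ x ∈ s, ∀ r, HasFDerivAt (fun x => g x r) (g' x r) x)
    (hg' : ContinuousOn (fun p : E × ℝ => g' p.1 p.2) (s ×ˢ univ)) {x : E} (hx : x ∈ s)
    (a b : ℝ) :
    HasFDerivAt (fun x => ∫ r in a..b, g x r) (∫ r in a..b, g' x r) x := by
  obtain ⟨ε, hε, hball, C, hC⟩ := exists_ball_bound hs hg' hx a b
  have hg'x : Continuous (g' x) :=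
    hg'.comp_continuous (f := fun r : ℝ => (x, r)) (by fun_prop) fun r => ⟨hx, mem_univ _⟩
  refine intervalIntegral.hasFDerivAt_integral_of_dominated_of_fderiv_le
    (Metric.ball_mem_nhds x hε) (bound := fun _ => C) ?_ ((hg x hx).intervalIntegrable _ _)
    hg'x.aestronglyMeasurable
    (Eventually.of_forall fun r hr y hy => hC r hr y hy) intervalIntegrable_const
    (Eventually.of_forall fun r _ y hy => hd y (hball hy) r)
  filter_upwards [hs.mem_nhds hx] with y hy using (hg y hy).aestronglyMeasurable

theorem hasDerivAt_intervalIntegral_param {g g' : ℝ → ℝ → ℝ} {s : Set ℝ} (hs : IsOpen s)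
    (hg : ∀ x ∈ s, Continuous (g x)) (hd : ∀ x ∈ s, ∀ r, HasDerivAt (fun x => g x r) (g' x r) x)
    (hg' : ContinuousOn (fun p : ℝ × ℝ => g' p.1 p.2) (s ×ˢ univ)) {x : ℝ} (hx : x ∈ s)
    (a b : ℝ) :
    HasDerivAt (fun x => ∫ r in a..b, g x r) (∫ r in a..b, g' x r) x := by
  obtain ⟨ε, hε, hball, C, hC⟩ := exists_ball_bound hs hg' hx a b
  have hg'x : Continuous (g' x) :=
    hg'.comp_continuous (f := fun r : ℝ => (x, r)) (by fun_prop) fun r => ⟨hx, mem_univ _⟩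
  refine (intervalIntegral.hasDerivAt_integral_of_dominated_loc_of_deriv_le
    (Metric.ball_mem_nhds x hε) (bound := fun _ => C) ?_ ((hg x hx).intervalIntegrable _ _)
    hg'x.aestronglyMeasurable
    (Eventually.of_forall fun r hr y hy => hC r hr y hy) intervalIntegrable_const
    (Eventually.of_forall fun r _ y hy => hd y (hball hy) r)).2
  filter_upwards [hs.mem_nhds hx] with y hy using (hg y hy).aestronglyMeasurable

theorem continuousOn_intervalIntegral_param {E F : Type*} [NormedAddCommGroup E]
    [ProperSpace E] [NormedAddCommGroup F] [NormedSpace ℝ F] {g : E → ℝ → F}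
    {s : Set E} (hs : IsOpen s)
    (hg : ContinuousOn (fun p : E × ℝ => g p.1 p.2) (s ×ˢ univ)) (a b : ℝ) :
    ContinuousOn (fun x => ∫ r in a..b, g x r) s := by
  intro x hx
  obtain ⟨ε, hε, hball, C, hC⟩ := exists_ball_bound hs hg hx a b
  refine (intervalIntegral.continuousAt_of_dominated_interval (bound := fun _ => C) ?_ ?_
    intervalIntegrable_const ?_).continuousWithinAt
  · filter_upwards [hs.mem_nhds hx] with y hy
    exact (hg.comp_continuous (f := fun r : ℝ => (y, r)) (by fun_prop)
      fun r => ⟨hy, mem_univ _⟩).aestronglyMeasurable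
  · filter_upwards [Metric.ball_mem_nhds x hε] with y hy
    exact Eventually.of_forall fun r hr => hC r hr y hy
  · refine Eventually.of_forall fun r _ => ?_
    have h1 : ContinuousAt (fun p : E × ℝ => g p.1 p.2) (x, r) :=
      hg.continuousAt ((hs.prod isOpen_univ).mem_nhds ⟨hx, mem_univ _⟩)
    exact h1.comp (f := fun y : E => (y, r)) (by fun_prop)

/-- Integration over a fixed interval preserves smoothness in the parameter. Both spaces lie in one
universe because the induction replaces `F` by `E →L[ℝ] F`. -/
theorem contDiffOn_intervalIntegral_param {E : Type} [NormedAddCommGroup E] [NormedSpace ℝ E]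
    [ProperSpace E] (n : ℕ) {F : Type} [NormedAddCommGroup F] [NormedSpace ℝ F] {g : E → ℝ → F}
    {s : Set E} (hs : IsOpen s)
    (hg : ContDiffOn ℝ n (fun p : E × ℝ => g p.1 p.2) (s ×ˢ univ)) (a b : ℝ) :
    ContDiffOn ℝ n (fun x => ∫ r in a..b, g x r) s := by
  have hU : IsOpen (s ×ˢ (univ : Set ℝ)) := hs.prod isOpen_univ
  induction n generalizing F with
  | zero =>
    simp only [CharP.cast_eq_zero, contDiffOn_zero] at hg ⊢
    exact continuousOn_intervalIntegral_param hs hg a b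
  | succ n ih =>
    have hfd := (contDiffOn_succ_iff_fderiv_of_isOpen (n := (n : WithTop ℕ∞)) (𝕜 := ℝ)
      (f := fun p : E × ℝ => g p.1 p.2) hU).1 (by exact_mod_cast hg)
    set g' : E → ℝ → E →L[ℝ] F := fun x r =>
      (fderiv ℝ (fun p : E × ℝ => g p.1 p.2) (x, r)).comp (ContinuousLinearMap.inl ℝ E ℝ) with hg'
    have hg'c : ContDiffOn ℝ n (fun p : E × ℝ => g' p.1 p.2) (s ×ˢ univ) :=
      hfd.2.2.clm_comp contDiffOn_const
    have hd : ∀ x ∈ s, ∀ r, HasFDerivAt (fun x => g x r) (g' x r) x := fun x hx r => by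
      have h1 : DifferentiableAt ℝ (fun p : E × ℝ => g p.1 p.2) (x, r) :=
        hfd.1.differentiableAt (hU.mem_nhds ⟨hx, mem_univ _⟩)
      exact h1.hasFDerivAt.comp (f := fun y : E => (y, r)) x (hasFDerivAt_prodMk_left x r)
    have hgc : ∀ x ∈ s, Continuous (g x) := fun x hx =>
      hg.continuousOn.comp_continuous (f := fun r : ℝ => (x, r)) (by fun_prop)
        fun r => ⟨hx, mem_univ _⟩
    have key : ∀ x ∈ s, HasFDerivAt (fun x => ∫ r in a..b, g x r) (∫ r in a..b, g' x r) x :=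
      fun x hx => hasFDerivAt_intervalIntegral_param hs hgc hd hg'c.continuousOn hx a b
    have := (contDiffOn_succ_iff_fderiv_of_isOpen (n := (n : WithTop ℕ∞)) (𝕜 := ℝ)
      (f := fun x => ∫ r in a..b, g x r) hs).2
      ⟨fun x hx => (key x hx).differentiableAt.differentiableWithinAt, by simp,
        (ih hg'c).congr fun x hx => (key x hx).fderiv⟩
    exact_mod_cast this

/-! ### The dimensionless kernel -/

/-- The horizontal factor of the dimensionless flux kernel. -/
noncomputable def lateralKernel (V W X Y r : ℝ) : ℝ :=
  1 / (1 + r ^ 2) * Real.exp (-(((X + V * r ^ 2) ^ 2 + (Y + W * r ^ 2) ^ 2) / (1 + r ^ 2)))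

/-- The dimensionless kernel of the flux term: the temperature caused at the point `(X, Y, Z)`,
relative to the present beam centre, by the heat supplied at the dimensionless elapsed time `r ^ 2`.
At `r = 0` the factor `exp (-Z² / r²)` takes the irrelevant value `1`. -/
noncomputable def kernel (V W X Y Z r : ℝ) : ℝ :=
  1 / (1 + r ^ 2) *
    Real.exp (-(((X + V * r ^ 2) ^ 2 + (Y + W * r ^ 2) ^ 2) / (1 + r ^ 2)) - Z ^ 2 / r ^ 2)

/-- The dimensionless temperature caused by a beam that has been on for the dimensionless time
`R ^ 2`. -/
noncomputable def kernelIntegral (V W X Y Z R : ℝ) : ℝ := ∫ r in (0 : ℝ)..R, kernel V W X Y Z r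

/-- The function `x ↦ x⁻ʲ exp (-1 / x)` for `x > 0`, extended by zero to a smooth function. At
`x = 0` it vanishes because `expNegInvGlue` does, whatever the value of `x⁻¹`. -/
noncomputable def flat (j : ℕ) (x : ℝ) : ℝ := x⁻¹ ^ j * expNegInvGlue x

theorem contDiff_flat (j : ℕ) {n : ℕ∞} : ContDiff ℝ n (flat j) := by
  have h := expNegInvGlue.contDiff_polynomial_eval_inv_mul (n := n)
    ((Polynomial.X : Polynomial ℝ) ^ j)
  simp only [Polynomial.eval_pow, Polynomial.eval_X] at h
  exact h

theorem hasDerivAt_flat (j : ℕ) (x : ℝ) :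
    HasDerivAt (flat j) (flat (j + 2) x - j * flat (j + 1) x) x := by
  have h := expNegInvGlue.hasDerivAt_polynomial_eval_inv_mul ((Polynomial.X : Polynomial ℝ) ^ j) x
  have h1 : (fun x : ℝ => Polynomial.eval x⁻¹ ((Polynomial.X : Polynomial ℝ) ^ j) *
      expNegInvGlue x) = flat j := by
    funext x; simp [flat]
  rw [h1] at h
  refine h.congr_deriv ?_
  cases j with
  | zero => simp [flat]
  | succ j => simp [flat]; ring

theorem mul_flat_succ (j : ℕ) (x : ℝ) : x * flat (j + 1) x = flat j x := by
  rcases eq_or_ne x 0 with rfl | hx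
  · simp [flat, expNegInvGlue.zero]
  · simp only [flat, pow_succ]; field_simp

theorem flat_zero_eq_exp {Z r : ℝ} (hZ : Z ≠ 0) (hr : r ≠ 0) :
    flat 0 (r ^ 2 / Z ^ 2) = Real.exp (-(Z ^ 2 / r ^ 2)) := by
  have : ¬ r ^ 2 / Z ^ 2 ≤ 0 := by
    push Not; positivity
  simp [flat, expNegInvGlue, this]

theorem kernel_eq_mul (V W X Y Z r : ℝ) :
    kernel V W X Y Z r = lateralKernel V W X Y r * Real.exp (-(Z ^ 2 / r ^ 2)) := by
  rw [kernel, lateralKernel, sub_eq_add_neg, Real.exp_add, mul_assoc]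

theorem kernel_swap (V W X Y Z r : ℝ) : kernel V W X Y Z r = kernel W V Y X Z r := by
  simp only [kernel, add_comm]

theorem kernelIntegral_swap (V W X Y Z R : ℝ) :
    kernelIntegral V W X Y Z R = kernelIntegral W V Y X Z R := by
  simp only [kernelIntegral, kernel_swap V]

theorem kernel_neg_z (V W X Y Z r : ℝ) : kernel V W X Y (-Z) r = kernel V W X Y Z r := by
  simp [kernel]

theorem lateralKernel_nonneg (V W X Y r : ℝ) : 0 ≤ lateralKernel V W X Y r := by
  unfold lateralKernel; positivity

theorem lateralKernel_le_one (V W X Y r : ℝ) : lateralKernel V W X Y r ≤ 1 := by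
  unfold lateralKernel
  refine mul_le_one₀ ?_ (Real.exp_pos _).le (Real.exp_le_one_iff.2 ?_)
  · rw [div_le_one (by positivity)]; nlinarith [sq_nonneg r]
  · have : 0 ≤ ((X + V * r ^ 2) ^ 2 + (Y + W * r ^ 2) ^ 2) / (1 + r ^ 2) := by positivity
    linarith

theorem kernel_nonneg (V W X Y Z r : ℝ) : 0 ≤ kernel V W X Y Z r := by
  unfold kernel; positivity

theorem kernel_le_one (V W X Y Z r : ℝ) : kernel V W X Y Z r ≤ 1 := by
  rw [kernel_eq_mul]
  refine mul_le_one₀ (lateralKernel_le_one ..) (Real.exp_pos _).le (Real.exp_le_one_iff.2 ?_)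
  have : 0 ≤ Z ^ 2 / r ^ 2 := by positivity
  linarith

theorem norm_kernel_le_one (V W X Y Z r : ℝ) : ‖kernel V W X Y Z r‖ ≤ 1 := by
  rw [Real.norm_of_nonneg (kernel_nonneg ..)]
  exact kernel_le_one ..

theorem measurable_kernel (V W : ℝ) :
    Measurable fun p : ℝ × ℝ × ℝ × ℝ => kernel V W p.1 p.2.1 p.2.2.1 p.2.2.2 := by
  unfold kernel; fun_prop

theorem measurable_kernel_right (V W X Y Z : ℝ) : Measurable (kernel V W X Y Z) := by
  unfold kernel; fun_prop

theorem intervalIntegrable_kernel (V W X Y Z a b : ℝ) :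
    IntervalIntegrable (kernel V W X Y Z) volume a b :=
  intervalIntegrable_const (c := (1 : ℝ)).mono_fun
    (measurable_kernel_right ..).aestronglyMeasurable
    (Eventually.of_forall fun r => by simpa using norm_kernel_le_one V W X Y Z r)

theorem continuous_lateralKernel (V W : ℝ) :
    Continuous fun p : ℝ × ℝ × ℝ => lateralKernel V W p.1 p.2.1 p.2.2 := by
  have : ∀ r : ℝ, 1 + r ^ 2 ≠ 0 := fun r => by positivity
  unfold lateralKernel
  fun_prop (disch := simp [this])

theorem contDiff_lateralKernel (V W : ℝ) {n : ℕ∞} :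
    ContDiff ℝ n fun p : ℝ × ℝ × ℝ => lateralKernel V W p.1 p.2.1 p.2.2 := by
  have : ∀ r : ℝ, 1 + r ^ 2 ≠ 0 := fun r => by positivity
  unfold lateralKernel
  fun_prop (disch := simp [this])

theorem abs_kernelIntegral_le (V W X Y Z R : ℝ) : |kernelIntegral V W X Y Z R| ≤ |R| := by
  have := intervalIntegral.norm_integral_le_of_norm_le_const (a := 0) (b := R) (C := 1)
    fun r _ => norm_kernel_le_one V W X Y Z r
  simpa [kernelIntegral] using this

/-- Off the surface, the temperature vanishes to third order when the beam is switched on. -/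
theorem abs_kernelIntegral_le_cube (V W X Y R : ℝ) {Z : ℝ} (hZ : Z ≠ 0) (hR : 0 ≤ R) :
    |kernelIntegral V W X Y Z R| ≤ R ^ 3 / Z ^ 2 := by
  have := intervalIntegral.norm_integral_le_of_norm_le_const (a := 0) (b := R)
    (C := R ^ 2 / Z ^ 2) (f := kernel V W X Y Z) fun r hr => by
      rw [uIoc_of_le hR] at hr
      rw [Real.norm_of_nonneg (kernel_nonneg ..), kernel_eq_mul]
      have h0 := hr.1
      have h1 : Real.exp (-(Z ^ 2 / r ^ 2)) ≤ r ^ 2 / Z ^ 2 := by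
        have h2 := Real.add_one_le_exp (Z ^ 2 / r ^ 2)
        rw [Real.exp_neg, ← inv_div (Z ^ 2)]
        exact inv_anti₀ (by positivity) (by linarith)
      have h3 : r ^ 2 / Z ^ 2 ≤ R ^ 2 / Z ^ 2 := by
        have := hr.2; gcongr
      calc lateralKernel V W X Y r * Real.exp (-(Z ^ 2 / r ^ 2))
          ≤ 1 * Real.exp (-(Z ^ 2 / r ^ 2)) := by
            gcongr; exact lateralKernel_le_one ..
        _ ≤ _ := by linarith
  rw [Real.norm_eq_abs, sub_zero, abs_of_nonneg hR] at this
  refine this.trans (le_of_eq ?_)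
  ring

theorem continuous_kernelIntegral (V W : ℝ) :
    Continuous fun p : (ℝ × ℝ × ℝ) × ℝ => kernelIntegral V W p.1.1 p.1.2.1 p.1.2.2 p.2 := by
  rw [continuous_iff_continuousAt]
  rintro ⟨p, R⟩
  refine intervalIntegral.continuousAt_parametric_primitive_of_dominated
    (F := fun p : ℝ × ℝ × ℝ => kernel V W p.1 p.2.1 p.2.2) (fun _ => 1)
    (-1 - |R|) (1 + |R|) (fun p => (measurable_kernel_right ..).aestronglyMeasurable) ?_
    intervalIntegrable_const ?_ ?_ ?_ (by simp)
  · exact Eventually.of_forall fun p => Eventually.of_forall fun r => norm_kernel_le_one ..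
  · refine Eventually.of_forall fun r => Continuous.continuousAt ?_
    simp only [kernel, div_eq_mul_inv]
    fun_prop
  · constructor <;> linarith [abs_nonneg R]
  · constructor <;> linarith [neg_abs_le R, le_abs_self R]

section

/-! ### The differential equation for the dimensionless temperature -/

/-- The kernel times `(Z² / r²)ʲ`, for `Z ≠ 0` extended smoothly to `r = 0`. The derivatives of the
kernel in `Z` are combinations of these functions. -/
noncomputable def smoothKernel (V W X Y Z r : ℝ) (j : ℕ) : ℝ :=
  lateralKernel V W X Y r * flat j (r ^ 2 / Z ^ 2)

theorem kernel_eq_smoothKernel (V W X Y : ℝ) {Z r : ℝ} (hZ : Z ≠ 0) (hr : r ≠ 0) :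
    kernel V W X Y Z r = smoothKernel V W X Y Z r 0 := by
  rw [kernel_eq_mul, smoothKernel, flat_zero_eq_exp hZ hr]

theorem kernelIntegral_eq_integral_smoothKernel (V W X Y R : ℝ) {Z : ℝ} (hZ : Z ≠ 0) :
    kernelIntegral V W X Y Z R = ∫ r in (0 : ℝ)..R, smoothKernel V W X Y Z r 0 := by
  refine intervalIntegral.integral_congr_ae ?_
  filter_upwards [Measure.ae_ne volume (0 : ℝ)] with r hr _ using
    kernel_eq_smoothKernel V W X Y hZ hr

theorem contDiffOn_smoothKernel (V W : ℝ) (j : ℕ) {n : ℕ∞} :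
    ContDiffOn ℝ n (fun p : ℝ × ℝ × ℝ × ℝ => smoothKernel V W p.1 p.2.1 p.2.2.1 p.2.2.2 j)
      {p | p.2.2.1 ≠ 0} := by
  refine ContDiffOn.mul ?_ ?_
  · exact ((contDiff_lateralKernel V W).comp
      (f := fun p : ℝ × ℝ × ℝ × ℝ => (p.1, p.2.1, p.2.2.2)) (by fun_prop)).contDiffOn
  · refine (contDiff_flat j).comp_contDiffOn ?_
    refine ContDiffOn.div (by fun_prop) (by fun_prop) fun p hp => pow_ne_zero 2 hp

theorem isOpen_ne_surface : IsOpen {p : ℝ × ℝ × ℝ × ℝ | p.2.2.1 ≠ 0} :=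
  isOpen_ne_fun (by fun_prop) continuous_const

/-- Off the surface, the dimensionless temperature is smooth, jointly in all variables; the
substitution `r = R w` makes the interval of integration constant. -/
theorem contDiffOn_kernelIntegral (V W : ℝ) :
    ContDiffOn ℝ 2 (fun p : ℝ × ℝ × ℝ × ℝ => kernelIntegral V W p.1 p.2.1 p.2.2.1 p.2.2.2)
      {p | p.2.2.1 ≠ 0} := by
  have h1 : ContDiffOn ℝ ((2 : ℕ) : WithTop ℕ∞) (fun p : ℝ × ℝ × ℝ × ℝ =>
      ∫ w in (0 : ℝ)..1, smoothKernel V W p.1 p.2.1 p.2.2.1 (p.2.2.2 * w) 0)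
      {p | p.2.2.1 ≠ 0} := by
    refine contDiffOn_intervalIntegral_param 2 isOpen_ne_surface ?_ 0 1
    exact (contDiffOn_smoothKernel V W 0 (n := 2)).comp
      (f := fun q : (ℝ × ℝ × ℝ × ℝ) × ℝ => (q.1.1, q.1.2.1, q.1.2.2.1, q.1.2.2.2 * q.2))
      (by fun_prop) fun q hq => hq.1
  have h2 : ContDiffOn ℝ 2 (fun p : ℝ × ℝ × ℝ × ℝ => p.2.2.2 *
      ∫ w in (0 : ℝ)..1, smoothKernel V W p.1 p.2.1 p.2.2.1 (p.2.2.2 * w) 0)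
      {p | p.2.2.1 ≠ 0} := ContDiffOn.mul (by fun_prop) h1
  refine h2.congr fun p hp => ?_
  rw [kernelIntegral_eq_integral_smoothKernel _ _ _ _ _ hp]
  have := intervalIntegral.mul_integral_comp_mul_left (a := 0) (b := 1)
    (f := fun r => smoothKernel V W p.1 p.2.1 p.2.2.1 r 0) p.2.2.2
  simpa using this.symm

variable (V W X Y : ℝ) {Z : ℝ}

theorem hasDerivAt_lateralKernel_x (r : ℝ) :
    HasDerivAt (fun X => lateralKernel V W X Y r)
      (-(2 * (X + V * r ^ 2) / (1 + r ^ 2)) * lateralKernel V W X Y r) X := by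
  have h1 : HasDerivAt (fun X => -(((X + V * r ^ 2) ^ 2 + (Y + W * r ^ 2) ^ 2) / (1 + r ^ 2)))
      (-(2 * (X + V * r ^ 2) / (1 + r ^ 2))) X := by
    have := (((((hasDerivAt_id X).add_const (V * r ^ 2)).pow 2).add_const
      ((Y + W * r ^ 2) ^ 2)).div_const (1 + r ^ 2)).neg
    exact this.congr_deriv (by simp)
  refine (h1.exp.const_mul (1 / (1 + r ^ 2))).congr_deriv ?_
  unfold lateralKernel; ring

theorem hasDerivAt_lateralKernel_xx (r : ℝ) :
    HasDerivAt (fun X => -(2 * (X + V * r ^ 2) / (1 + r ^ 2)) * lateralKernel V W X Y r)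
      ((4 * (X + V * r ^ 2) ^ 2 / (1 + r ^ 2) ^ 2 - 2 / (1 + r ^ 2)) * lateralKernel V W X Y r)
      X := by
  have h1 : HasDerivAt (fun X => -(2 * (X + V * r ^ 2) / (1 + r ^ 2))) (-(2 / (1 + r ^ 2))) X := by
    have := ((((hasDerivAt_id X).add_const (V * r ^ 2)).const_mul 2).div_const (1 + r ^ 2)).neg
    exact this.congr_deriv (by simp)
  refine (h1.mul (hasDerivAt_lateralKernel_x V W X Y r)).congr_deriv ?_
  have : 1 + r ^ 2 ≠ 0 := by positivity
  field_simp
  ring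

theorem hasDerivAt_lateralKernel_r (r : ℝ) :
    HasDerivAt (fun r => lateralKernel V W X Y r)
      ((-(2 * r / (1 + r ^ 2)) - (4 * V * r * (X + V * r ^ 2) + 4 * W * r * (Y + W * r ^ 2))
          / (1 + r ^ 2) + 2 * r * ((X + V * r ^ 2) ^ 2 + (Y + W * r ^ 2) ^ 2) / (1 + r ^ 2) ^ 2)
        * lateralKernel V W X Y r) r := by
  have hne : 1 + r ^ 2 ≠ 0 := by positivity
  have h2 : HasDerivAt (fun r : ℝ => r ^ 2) (2 * r) r := by simpa using hasDerivAt_pow 2 r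
  have h3 : HasDerivAt (fun r : ℝ => 1 + r ^ 2) (2 * r) r := h2.const_add 1
  have hP : ∀ X V : ℝ, HasDerivAt (fun r => (X + V * r ^ 2) ^ 2)
      (2 * (X + V * r ^ 2) * (V * (2 * r))) r := fun X V => by
    exact (((h2.const_mul V).const_add X).pow 2).congr_deriv (by simp)
  have h4 := (((hP X V).add (hP Y W)).div h3 hne).neg
  have h5 := ((hasDerivAt_const r (1 : ℝ)).div h3 hne).mul h4.exp
  refine h5.congr_deriv ?_
  unfold lateralKernel
  simp only [Pi.add_apply, Pi.neg_apply, Pi.div_apply]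
  field_simp
  ring

theorem hasDerivAt_flat_z (j : ℕ) (hZ : Z ≠ 0) (r : ℝ) :
    HasDerivAt (fun Z => flat j (r ^ 2 / Z ^ 2))
      (-(2 / Z) * (flat (j + 1) (r ^ 2 / Z ^ 2) - j * flat j (r ^ 2 / Z ^ 2))) Z := by
  have h1 : HasDerivAt (fun Z : ℝ => r ^ 2 / Z ^ 2) (-(2 / Z) * (r ^ 2 / Z ^ 2)) Z := by
    have := (hasDerivAt_const Z (r ^ 2)).div (hasDerivAt_pow 2 Z) (pow_ne_zero 2 hZ)
    refine this.congr_deriv ?_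
    field_simp
    ring
  refine ((hasDerivAt_flat j _).comp Z h1).congr_deriv ?_
  linear_combination (-(2 / Z)) * mul_flat_succ (j + 1) (r ^ 2 / Z ^ 2)
    + (2 / Z) * j * mul_flat_succ j (r ^ 2 / Z ^ 2)

theorem hasDerivAt_flat_r (j : ℕ) (r : ℝ) :
    HasDerivAt (fun r => flat j (r ^ 2 / Z ^ 2))
      ((flat (j + 2) (r ^ 2 / Z ^ 2) - j * flat (j + 1) (r ^ 2 / Z ^ 2)) * (2 * r / Z ^ 2)) r := by
  have h1 : HasDerivAt (fun r : ℝ => r ^ 2 / Z ^ 2) (2 * r / Z ^ 2) r := by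
    simpa using (hasDerivAt_pow 2 r).div_const (Z ^ 2)
  exact (hasDerivAt_flat j _).comp r h1

/-- The derivative of the dimensionless temperature in `X`. -/
noncomputable def kernelIntegralX (V W X Y Z R : ℝ) : ℝ :=
  ∫ r in (0 : ℝ)..R, -(2 * (X + V * r ^ 2) / (1 + r ^ 2)) * smoothKernel V W X Y Z r 0

/-- The second derivative of the dimensionless temperature in `X`. -/
noncomputable def kernelIntegralXX (V W X Y Z R : ℝ) : ℝ :=
  ∫ r in (0 : ℝ)..R, (4 * (X + V * r ^ 2) ^ 2 / (1 + r ^ 2) ^ 2 - 2 / (1 + r ^ 2)) *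
    smoothKernel V W X Y Z r 0

/-- The derivative of the dimensionless temperature in `Z`. -/
noncomputable def kernelIntegralZ (V W X Y Z R : ℝ) : ℝ :=
  ∫ r in (0 : ℝ)..R, -(2 / Z) * smoothKernel V W X Y Z r 1

/-- The second derivative of the dimensionless temperature in `Z`. -/
noncomputable def kernelIntegralZZ (V W X Y Z R : ℝ) : ℝ :=
  ∫ r in (0 : ℝ)..R,
    (4 * smoothKernel V W X Y Z r 2 - 2 * smoothKernel V W X Y Z r 1) / Z ^ 2

theorem continuous_smoothKernel_x (hZ : Z ≠ 0) (j : ℕ) :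
    Continuous fun p : ℝ × ℝ => smoothKernel V W p.1 Y Z p.2 j :=
  (contDiffOn_smoothKernel V W j (n := 0)).continuousOn.comp_continuous
    (f := fun p : ℝ × ℝ => (p.1, Y, Z, p.2)) (by fun_prop) fun _ => hZ

theorem continuous_smoothKernel_r (hZ : Z ≠ 0) (j : ℕ) :
    Continuous fun r : ℝ => smoothKernel V W X Y Z r j :=
  (continuous_smoothKernel_x V W Y hZ j).comp (f := fun r : ℝ => (X, r)) (by fun_prop)

theorem continuousOn_smoothKernel_z (j : ℕ) :
    ContinuousOn (fun p : ℝ × ℝ => smoothKernel V W X Y p.1 p.2 j) ({0}ᶜ ×ˢ univ) :=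
  (contDiffOn_smoothKernel V W j (n := 0)).continuousOn.comp
    (f := fun p : ℝ × ℝ => (X, Y, p.1, p.2)) (by fun_prop) fun _ hp => hp.1

theorem continuous_coeff_x :
    Continuous fun p : ℝ × ℝ => -(2 * (p.1 + V * p.2 ^ 2) / (1 + p.2 ^ 2)) := by
  have : ∀ r : ℝ, 1 + r ^ 2 ≠ 0 := fun r => by positivity
  fun_prop (disch := simp [this])

theorem continuous_coeff_xx :
    Continuous fun p : ℝ × ℝ =>
      4 * (p.1 + V * p.2 ^ 2) ^ 2 / (1 + p.2 ^ 2) ^ 2 - 2 / (1 + p.2 ^ 2) := by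
  have : ∀ r : ℝ, 1 + r ^ 2 ≠ 0 := fun r => by positivity
  fun_prop (disch := simp [this])

theorem continuous_kernelIntegralX_integrand (hZ : Z ≠ 0) : Continuous fun p : ℝ × ℝ =>
    -(2 * (p.1 + V * p.2 ^ 2) / (1 + p.2 ^ 2)) * smoothKernel V W p.1 Y Z p.2 0 :=
  (continuous_coeff_x V).mul (continuous_smoothKernel_x V W Y hZ 0)

theorem continuous_kernelIntegralXX_integrand (hZ : Z ≠ 0) : Continuous fun p : ℝ × ℝ =>
    (4 * (p.1 + V * p.2 ^ 2) ^ 2 / (1 + p.2 ^ 2) ^ 2 - 2 / (1 + p.2 ^ 2)) *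
      smoothKernel V W p.1 Y Z p.2 0 :=
  (continuous_coeff_xx V).mul (continuous_smoothKernel_x V W Y hZ 0)

theorem hasDerivAt_kernelIntegral_x (hZ : Z ≠ 0) (R : ℝ) :
    HasDerivAt (fun X => kernelIntegral V W X Y Z R) (kernelIntegralX V W X Y Z R) X := by
  simp only [kernelIntegral_eq_integral_smoothKernel _ _ _ _ _ hZ]
  refine hasDerivAt_intervalIntegral_param
    (g' := fun X r => -(2 * (X + V * r ^ 2) / (1 + r ^ 2)) * smoothKernel V W X Y Z r 0)
    isOpen_univ (fun X _ => continuous_smoothKernel_r V W X Y hZ 0) (fun X _ r => ?_)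
    (continuous_kernelIntegralX_integrand V W Y hZ).continuousOn (mem_univ X) 0 R
  exact ((hasDerivAt_lateralKernel_x V W X Y r).mul_const _).congr_deriv (mul_assoc _ _ _)

theorem hasDerivAt_kernelIntegralX (hZ : Z ≠ 0) (R : ℝ) :
    HasDerivAt (fun X => kernelIntegralX V W X Y Z R) (kernelIntegralXX V W X Y Z R) X := by
  refine hasDerivAt_intervalIntegral_param
    (g := fun X r => -(2 * (X + V * r ^ 2) / (1 + r ^ 2)) * smoothKernel V W X Y Z r 0)
    (g' := fun X r => (4 * (X + V * r ^ 2) ^ 2 / (1 + r ^ 2) ^ 2 - 2 / (1 + r ^ 2)) *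
      smoothKernel V W X Y Z r 0) isOpen_univ
    (fun X _ => (continuous_kernelIntegralX_integrand V W Y hZ).comp
      (f := fun r : ℝ => (X, r)) (by fun_prop)) (fun X _ r => ?_)
    (continuous_kernelIntegralXX_integrand V W Y hZ).continuousOn (mem_univ X) 0 R
  simp only [smoothKernel, ← mul_assoc]
  exact (hasDerivAt_lateralKernel_xx V W X Y r).mul_const _

theorem hasDerivAt_kernelIntegral_z (hZ : Z ≠ 0) (R : ℝ) :
    HasDerivAt (fun Z => kernelIntegral V W X Y Z R) (kernelIntegralZ V W X Y Z R) Z := by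
  have h1 : (fun Z => kernelIntegral V W X Y Z R) =ᶠ[𝓝 Z]
      fun Z => ∫ r in (0 : ℝ)..R, smoothKernel V W X Y Z r 0 := by
    filter_upwards [isOpen_ne.mem_nhds hZ] with Z hZ using
      kernelIntegral_eq_integral_smoothKernel _ _ _ _ _ hZ
  refine HasDerivAt.congr_of_eventuallyEq ?_ h1
  refine hasDerivAt_intervalIntegral_param (s := {0}ᶜ)
    (g' := fun Z r => -(2 / Z) * smoothKernel V W X Y Z r 1) isOpen_compl_singleton
    (fun Z hZ => continuous_smoothKernel_r V W X Y hZ 0) (fun Z hZ r => ?_) ?_ hZ 0 R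
  · refine ((hasDerivAt_flat_z 0 hZ r).const_mul (lateralKernel V W X Y r)).congr_deriv ?_
    simp [smoothKernel]; ring
  · refine ContinuousOn.mul ?_ (continuousOn_smoothKernel_z V W X Y 1)
    exact (continuousOn_const.div (by fun_prop) fun p hp => hp.1).neg

theorem hasDerivAt_kernelIntegralZ (hZ : Z ≠ 0) (R : ℝ) :
    HasDerivAt (fun Z => kernelIntegralZ V W X Y Z R) (kernelIntegralZZ V W X Y Z R) Z := by
  refine hasDerivAt_intervalIntegral_param (s := {0}ᶜ)
    (g := fun Z r => -(2 / Z) * smoothKernel V W X Y Z r 1)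
    (g' := fun Z r => (4 * smoothKernel V W X Y Z r 2 - 2 * smoothKernel V W X Y Z r 1) / Z ^ 2)
    isOpen_compl_singleton (fun Z hZ => continuous_const.mul (continuous_smoothKernel_r V W X Y hZ 1))
    (fun Z hZ r => ?_) ?_ hZ 0 R
  · have hZ' : Z ≠ 0 := hZ
    have h1 : HasDerivAt (fun Z : ℝ => -(2 / Z)) (2 / Z ^ 2) Z := by
      have := ((hasDerivAt_const Z (2 : ℝ)).div (hasDerivAt_id Z) hZ).neg
      exact this.congr_deriv (by simp; ring)
    have h2 := h1.mul ((hasDerivAt_flat_z 1 hZ r).const_mul (lateralKernel V W X Y r))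
    refine h2.congr_deriv ?_
    simp only [smoothKernel, Nat.cast_one, one_mul]
    field_simp
    ring
  · refine ContinuousOn.div ?_ (by fun_prop) fun p hp => pow_ne_zero 2 hp.1
    exact (continuousOn_const.mul (continuousOn_smoothKernel_z V W X Y 2)).sub
      (continuousOn_const.mul (continuousOn_smoothKernel_z V W X Y 1))

/-- The heat equation for the dimensionless temperature. For the integrands, it reads
`ΔK + 4 V K_X + 4 W K_Y = 2 ∂ᵣ (K / r)`, and the fundamental theorem of calculus applies because
`K / r` vanishes at `r = 0` when `Z ≠ 0`. -/
theorem kernelIntegral_heat (hZ : Z ≠ 0) {R : ℝ} (hR : R ≠ 0) :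
    kernelIntegralXX V W X Y Z R + kernelIntegralXX W V Y X Z R + kernelIntegralZZ V W X Y Z R
      = -4 * V * kernelIntegralX V W X Y Z R - 4 * W * kernelIntegralX W V Y X Z R
        + 2 * kernel V W X Y Z R / R := by
  have hswap : ∀ r j, smoothKernel W V Y X Z r j = smoothKernel V W X Y Z r j := fun r j => by
    simp only [smoothKernel, lateralKernel, add_comm]
  set F₁ : ℝ → ℝ := fun r => -(2 * (X + V * r ^ 2) / (1 + r ^ 2)) * smoothKernel V W X Y Z r 0
    with hF₁
  set F₂ : ℝ → ℝ := fun r => -(2 * (Y + W * r ^ 2) / (1 + r ^ 2)) * smoothKernel W V Y X Z r 0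
    with hF₂
  set F₃ : ℝ → ℝ := fun r => (4 * (X + V * r ^ 2) ^ 2 / (1 + r ^ 2) ^ 2 - 2 / (1 + r ^ 2)) *
    smoothKernel V W X Y Z r 0 with hF₃
  set F₄ : ℝ → ℝ := fun r => (4 * (Y + W * r ^ 2) ^ 2 / (1 + r ^ 2) ^ 2 - 2 / (1 + r ^ 2)) *
    smoothKernel W V Y X Z r 0 with hF₄
  set F₅ : ℝ → ℝ := fun r =>
    (4 * smoothKernel V W X Y Z r 2 - 2 * smoothKernel V W X Y Z r 1) / Z ^ 2 with hF₅
  have i1 : Continuous F₁ :=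
    (continuous_kernelIntegralX_integrand V W Y hZ).comp (f := fun r : ℝ => (X, r)) (by fun_prop)
  have i2 : Continuous F₂ :=
    (continuous_kernelIntegralX_integrand W V X hZ).comp (f := fun r : ℝ => (Y, r)) (by fun_prop)
  have i3 : Continuous F₃ :=
    (continuous_kernelIntegralXX_integrand V W Y hZ).comp (f := fun r : ℝ => (X, r)) (by fun_prop)
  have i4 : Continuous F₄ :=
    (continuous_kernelIntegralXX_integrand W V X hZ).comp (f := fun r : ℝ => (Y, r)) (by fun_prop)
  have i5 : Continuous F₅ :=
    ((continuous_const.mul (continuous_smoothKernel_r V W X Y hZ 2)).sub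
      (continuous_const.mul (continuous_smoothKernel_r V W X Y hZ 1))).div_const _
  set S : ℝ → ℝ := fun r => F₃ r + F₄ r + F₅ r + (4 * V * F₁ r + 4 * W * F₂ r) with hS
  have hSc : Continuous S := by fun_prop
  have hderiv : ∀ r, HasDerivAt (fun r => 2 * (lateralKernel V W X Y r *
      (r / Z ^ 2 * flat 1 (r ^ 2 / Z ^ 2)))) (S r) r := fun r => by
    have h1 := ((hasDerivAt_lateralKernel_r V W X Y r).mul
      (((hasDerivAt_id r).div_const (Z ^ 2)).mul (hasDerivAt_flat_r (Z := Z) 1 r))).const_mul 2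
    refine h1.congr_deriv ?_
    have e1 := mul_flat_succ 1 (r ^ 2 / Z ^ 2)
    have e2 := mul_flat_succ 2 (r ^ 2 / Z ^ 2)
    have e0 := mul_flat_succ 0 (r ^ 2 / Z ^ 2)
    simp only [hS, hF₁, hF₂, hF₃, hF₄, hF₅, hswap]
    simp only [smoothKernel, id, Nat.cast_one, one_mul]
    norm_num only [Nat.reduceAdd] at e0 e1 e2 ⊢
    -- All powers of `r² / Z²` are absorbed into the highest `flat`; the rest is algebra.
    rw [← e0, ← e1, ← e2]
    have hne : 1 + r ^ 2 ≠ 0 := by positivity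
    simp only [Pi.mul_apply]
    rw [← e1, ← e2]
    field_simp
    ring
  have hFTC := intervalIntegral.integral_eq_sub_of_hasDerivAt (a := 0) (b := R)
    (fun r _ => hderiv r) (hSc.intervalIntegrable _ _)
  -- The upper end contributes `2 K / R`, the lower one nothing.
  have hend : 2 * (lateralKernel V W X Y R * (R / Z ^ 2 * flat 1 (R ^ 2 / Z ^ 2)))
      = 2 * kernel V W X Y Z R / R := by
    rw [kernel_eq_smoothKernel V W X Y hZ hR, smoothKernel, ← mul_flat_succ 0]
    field_simp
  rw [hend] at hFTC
  have hsum : ∫ r in (0 : ℝ)..R, S r = (∫ r in (0 : ℝ)..R, F₃ r) + (∫ r in (0 : ℝ)..R, F₄ r)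
      + (∫ r in (0 : ℝ)..R, F₅ r)
      + (4 * V * (∫ r in (0 : ℝ)..R, F₁ r) + 4 * W * ∫ r in (0 : ℝ)..R, F₂ r) := by
    have j1 : Continuous fun r => F₃ r + F₄ r := by fun_prop
    have j2 : Continuous fun r => F₃ r + F₄ r + F₅ r := by fun_prop
    have j3 : Continuous fun r => 4 * V * F₁ r := by fun_prop
    have j4 : Continuous fun r => 4 * W * F₂ r := by fun_prop
    have j5 : Continuous fun r => 4 * V * F₁ r + 4 * W * F₂ r := by fun_prop
    rw [intervalIntegral.integral_add (j2.intervalIntegrable _ _) (j5.intervalIntegrable _ _),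
      intervalIntegral.integral_add (j1.intervalIntegrable _ _) (i5.intervalIntegrable _ _),
      intervalIntegral.integral_add (i3.intervalIntegrable _ _) (i4.intervalIntegrable _ _),
      intervalIntegral.integral_add (j3.intervalIntegrable _ _) (j4.intervalIntegrable _ _),
      intervalIntegral.integral_const_mul, intervalIntegral.integral_const_mul]
  rw [hsum] at hFTC
  simp only [kernelIntegralX, kernelIntegralXX, kernelIntegralZZ]
  simp only [zero_div, zero_mul, mul_zero, sub_zero] at hFTC
  linarith

theorem hasDerivAt_kernelIntegral_r {R : ℝ} (hZ : Z ≠ 0) (hR : R ≠ 0) :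
    HasDerivAt (fun R => kernelIntegral V W X Y Z R) (kernel V W X Y Z R) R := by
  simp only [kernelIntegral_eq_integral_smoothKernel _ _ _ _ _ hZ,
    kernel_eq_smoothKernel V W X Y hZ hR]
  exact intervalIntegral.integral_hasDerivAt_right
    ((continuous_smoothKernel_r V W X Y hZ 0).intervalIntegrable _ _)
    (continuous_smoothKernel_r V W X Y hZ 0).stronglyMeasurable.stronglyMeasurableAtFilter
    (continuous_smoothKernel_r V W X Y hZ 0).continuousAt

end

section

/-! ### The normal derivative at the surface -/

theorem integral_flat_one_sq : ∫ w in Ioi (0 : ℝ), flat 1 (w ^ 2) = √Real.pi / 2 := by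
  have h1 := integral_comp_rpow_Ioi (fun y : ℝ => Real.exp (-1 * y ^ 2)) (p := -1) (by norm_num)
  rw [integral_gaussian_Ioi, div_one] at h1
  rw [← h1]
  refine setIntegral_congr_fun measurableSet_Ioi fun w hw => ?_
  have hw : 0 < w := hw
  have h2 : ¬ w ^ 2 ≤ 0 := by push Not; positivity
  simp only [flat, expNegInvGlue, h2, if_false, smul_eq_mul, pow_one, Real.rpow_neg_one]
  rw [show (-1 - 1 : ℝ) = -((2 : ℕ) : ℝ) by norm_num, Real.rpow_neg hw.le, Real.rpow_natCast]
  simp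

theorem integrableOn_flat_one_sq : IntegrableOn (fun w : ℝ => flat 1 (w ^ 2)) (Ioi 0) := by
  refine Integrable.of_integral_ne_zero ?_
  rw [integral_flat_one_sq]
  positivity

variable (V W X Y : ℝ)

/-- The substitution `r = |Z| w` in the normal derivative. -/
theorem kernelIntegralZ_eq_integral_Ioi {Z R : ℝ} (hZ : Z < 0) (hR : 0 < R) :
    kernelIntegralZ V W X Y Z R = ∫ w in Ioi (0 : ℝ), (Iic (R / -Z)).indicator
      (fun w => 2 * (lateralKernel V W X Y (-Z * w) * flat 1 (w ^ 2))) w := by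
  have hc : 0 < -Z := by linarith
  rw [setIntegral_indicator measurableSet_Iic, Ioi_inter_Iic,
    ← intervalIntegral.integral_of_le (by positivity), kernelIntegralZ]
  have h := intervalIntegral.mul_integral_comp_mul_left (a := 0) (b := R / -Z)
    (f := fun r => -(2 / Z) * smoothKernel V W X Y Z r 1) (-Z)
  rw [mul_zero, mul_div_cancel₀ _ hc.ne'] at h
  rw [← h, ← intervalIntegral.integral_const_mul]
  congr 1
  funext w
  have hZ' : Z ≠ 0 := hZ.ne
  have h2 : (-Z * w) ^ 2 / Z ^ 2 = w ^ 2 := by field_simp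
  rw [smoothKernel, h2]
  field_simp

/-- The one-sided normal derivative at the surface, as the limit of the normal derivative inside:
after the substitution `r = |Z| w`, the kernel is an approximate identity. -/
theorem hasDerivWithinAt_kernelIntegral_surface {R : ℝ} (hR : 0 < R) :
    HasDerivWithinAt (fun Z => kernelIntegral V W X Y Z R)
      (√Real.pi * Real.exp (-(X ^ 2 + Y ^ 2))) (Iic 0) 0 := by
  refine hasDerivWithinAt_Iic_of_tendsto_deriv (s := Iio 0)
    (fun Z hZ => (hasDerivAt_kernelIntegral_z V W X Y (ne_of_lt hZ)
      R).differentiableAt.differentiableWithinAt) ?_ self_mem_nhdsWithin ?_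
  · exact ((continuous_kernelIntegral V W).comp
      (f := fun Z : ℝ => ((X, Y, Z), R)) (by fun_prop)).continuousWithinAt
  have h1 : (fun Z => deriv (fun Z => kernelIntegral V W X Y Z R) Z) =ᶠ[𝓝[<] 0]
      fun Z => ∫ w in Ioi (0 : ℝ), (Iic (R / -Z)).indicator
        (fun w => 2 * (lateralKernel V W X Y (-Z * w) * flat 1 (w ^ 2))) w := by
    filter_upwards [self_mem_nhdsWithin] with Z hZ
    rw [(hasDerivAt_kernelIntegral_z V W X Y (ne_of_lt hZ) R).deriv,
      kernelIntegralZ_eq_integral_Ioi V W X Y hZ hR]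
  rw [tendsto_congr' h1]
  have h2 : √Real.pi * Real.exp (-(X ^ 2 + Y ^ 2)) = ∫ w in Ioi (0 : ℝ),
      2 * (lateralKernel V W X Y 0 * flat 1 (w ^ 2)) := by
    rw [integral_const_mul, integral_const_mul, integral_flat_one_sq]
    simp [lateralKernel]
    ring
  rw [h2]
  have hnn : ∀ w : ℝ, 0 ≤ flat 1 (w ^ 2) := fun w =>
    mul_nonneg (by positivity) (expNegInvGlue.nonneg _)
  have hAc : Continuous fun r => lateralKernel V W X Y r :=
    (continuous_lateralKernel V W).comp (f := fun r : ℝ => (X, Y, r)) (by fun_prop)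
  have hfc : Continuous fun w : ℝ => flat 1 (w ^ 2) :=
    (contDiff_flat 1 (n := 0)).continuous.comp (by fun_prop)
  refine tendsto_integral_filter_of_dominated_convergence (fun w => 2 * flat 1 (w ^ 2)) ?_ ?_
    (integrableOn_flat_one_sq.const_mul 2) ?_
  · refine Eventually.of_forall fun Z => ?_
    refine AEStronglyMeasurable.indicator ?_ measurableSet_Iic
    exact (continuous_const.mul ((hAc.comp (f := fun w : ℝ => -Z * w)
      (by fun_prop)).mul hfc)).aestronglyMeasurable
  · refine Eventually.of_forall fun Z => Eventually.of_forall fun w => ?_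
    refine (norm_indicator_le_norm_self _ _).trans ?_
    have h3 := lateralKernel_nonneg V W X Y (-Z * w)
    rw [Real.norm_of_nonneg (by have := hnn w; positivity)]
    have := mul_le_mul_of_nonneg_right (lateralKernel_le_one V W X Y (-Z * w)) (hnn w)
    linarith
  · refine (ae_restrict_iff' measurableSet_Ioi).2 (Eventually.of_forall fun w hw => ?_)
    have hw : 0 < w := hw
    have h4 : ∀ᶠ Z : ℝ in 𝓝[<] 0, w ≤ R / -Z := by
      have : Ioo (-(R / w)) 0 ∈ 𝓝[<] (0 : ℝ) := Ioo_mem_nhdsLT (by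
        have : 0 < R / w := by positivity
        linarith)
      filter_upwards [this] with Z hZ
      have h5 : -Z < R / w := by linarith [hZ.1]
      rw [lt_div_iff₀ hw] at h5
      rw [le_div_iff₀ (by linarith [hZ.2])]
      linarith
    have h6 : Tendsto (fun Z : ℝ => 2 * (lateralKernel V W X Y (-Z * w) * flat 1 (w ^ 2)))
        (𝓝[<] 0) (𝓝 (2 * (lateralKernel V W X Y 0 * flat 1 (w ^ 2)))) := by
      have : Continuous fun Z : ℝ => 2 * (lateralKernel V W X Y (-Z * w) * flat 1 (w ^ 2)) :=
        continuous_const.mul ((hAc.comp (f := fun Z : ℝ => -Z * w) (by fun_prop)).mul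
          continuous_const)
      have h7 := (this.tendsto 0).mono_left (nhdsWithin_le_nhds (s := Iio 0))
      simpa using h7
    refine h6.congr' ?_
    filter_upwards [h4] with Z hZ
    rw [indicator_of_mem (show w ∈ Iic (R / -Z) from hZ)]

/-! ### The temperature caused by a beam that is switched on -/

/-- The chain rule along a curve at constant depth. -/
theorem hasDerivAt_kernelIntegral_curve {Xc Yc Rc : ℝ → ℝ} {X' Y' R' t Z : ℝ}
    (hX : HasDerivAt Xc X' t) (hY : HasDerivAt Yc Y' t) (hR : HasDerivAt Rc R' t)
    (hZ : Z ≠ 0) (hRt : Rc t ≠ 0) :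
    HasDerivAt (fun t => kernelIntegral V W (Xc t) (Yc t) Z (Rc t))
      (X' * kernelIntegralX V W (Xc t) (Yc t) Z (Rc t)
        + Y' * kernelIntegralX W V (Yc t) (Xc t) Z (Rc t)
        + R' * kernel V W (Xc t) (Yc t) Z (Rc t)) t := by
  set F : ℝ × ℝ × ℝ × ℝ → ℝ := fun p => kernelIntegral V W p.1 p.2.1 p.2.2.1 p.2.2.2
  have hF : HasFDerivAt F (fderiv ℝ F (Xc t, Yc t, Z, Rc t)) (Xc t, Yc t, Z, Rc t) :=
    (((contDiffOn_kernelIntegral V W).contDiffAt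
      (isOpen_ne_surface.mem_nhds hZ)).differentiableAt (by simp)).hasFDerivAt
  set L := fderiv ℝ F (Xc t, Yc t, Z, Rc t)
  have e1 : L (1, 0, 0, 0) = kernelIntegralX V W (Xc t) (Yc t) Z (Rc t) := by
    have h1 : HasDerivAt (fun X : ℝ => (X, Yc t, Z, Rc t)) ((1 : ℝ), (0 : ℝ), (0 : ℝ), (0 : ℝ))
        (Xc t) := (hasDerivAt_id _).prodMk (hasDerivAt_const _ _)
    exact (show HasDerivAt (fun X => F (X, Yc t, Z, Rc t)) _ _ from
      HasFDerivAt.comp_hasDerivAt (l := F) (l' := L) (Xc t) hF h1).unique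
      (hasDerivAt_kernelIntegral_x V W (Xc t) (Yc t) hZ (Rc t))
  have e2 : L (0, 1, 0, 0) = kernelIntegralX W V (Yc t) (Xc t) Z (Rc t) := by
    have h1 : HasDerivAt (fun Y : ℝ => (Xc t, Y, Z, Rc t)) ((0 : ℝ), (1 : ℝ), (0 : ℝ), (0 : ℝ))
        (Yc t) := (hasDerivAt_const _ _).prodMk ((hasDerivAt_id _).prodMk (hasDerivAt_const _ _))
    have h2 := hasDerivAt_kernelIntegral_x W V (Yc t) (Xc t) hZ (Rc t)
    simp only [kernelIntegral_swap W V] at h2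
    exact (show HasDerivAt (fun Y => F (Xc t, Y, Z, Rc t)) _ _ from
      HasFDerivAt.comp_hasDerivAt (l := F) (l' := L) (Yc t) hF h1).unique h2
  have e3 : L (0, 0, 0, 1) = kernel V W (Xc t) (Yc t) Z (Rc t) := by
    have h1 : HasDerivAt (fun R : ℝ => (Xc t, Yc t, Z, R)) ((0 : ℝ), (0 : ℝ), (0 : ℝ), (1 : ℝ))
        (Rc t) := (hasDerivAt_const _ _).prodMk ((hasDerivAt_const _ _).prodMk
          ((hasDerivAt_const _ _).prodMk (hasDerivAt_id _)))
    exact (show HasDerivAt (fun R => F (Xc t, Yc t, Z, R)) _ _ from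
      HasFDerivAt.comp_hasDerivAt (l := F) (l' := L) (Rc t) hF h1).unique
      (hasDerivAt_kernelIntegral_r V W (Xc t) (Yc t) hZ hRt)
  have hcurve : HasDerivAt (fun t => (Xc t, Yc t, Z, Rc t)) (X', Y', (0 : ℝ), R') t :=
    hX.prodMk (hY.prodMk ((hasDerivAt_const _ _).prodMk hR))
  refine (HasFDerivAt.comp_hasDerivAt t hF hcurve).congr_deriv ?_
  have hdec : ((X', Y', (0 : ℝ), R') : ℝ × ℝ × ℝ × ℝ)
      = X' • (1, 0, 0, 0) + Y' • (0, 1, 0, 0) + R' • (0, 0, 0, 1) := by simp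
  rw [hdec, map_add, map_add, map_smul, map_smul, map_smul, e1, e2, e3]
  simp only [smul_eq_mul]

theorem deriv_deriv_comp_affine {φ φ' : ℝ → ℝ} {a c d A : ℝ}
    (h1 : ∀ᶠ y in 𝓝 a, HasDerivAt φ (φ' y) y) (h2 : HasDerivAt φ' d a) :
    deriv (deriv fun h : ℝ => A * φ (a + c * h)) 0 = A * c ^ 2 * d := by
  have hl : ∀ h : ℝ, HasDerivAt (fun h : ℝ => a + c * h) c h := fun h => by
    simpa using ((hasDerivAt_id h).const_mul c).const_add a
  have ht : Tendsto (fun h : ℝ => a + c * h) (𝓝 0) (𝓝 a) := by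
    simpa using (hl 0).continuousAt.tendsto
  have h3 : (deriv fun h : ℝ => A * φ (a + c * h)) =ᶠ[𝓝 0] fun h => A * (φ' (a + c * h) * c) := by
    filter_upwards [ht.eventually h1] with h hh
    exact ((hh.comp h (hl h)).const_mul A).deriv
  rw [h3.deriv_eq]
  have h2' : HasDerivAt φ' d (a + c * 0) := by simpa using h2
  have h4 : HasDerivAt (fun h : ℝ => A * (φ' (a + c * h) * c)) (A * (d * c * c)) 0 :=
    ((h2'.comp (0 : ℝ) (hl 0)).mul_const c).const_mul A
  rw [h4.deriv]
  ring

theorem pi_rpow_three_halves : Real.pi ^ (3 / 2 : ℝ) = Real.pi * √Real.pi := by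
  rw [show (3 / 2 : ℝ) = 1 + 1 / 2 by norm_num, Real.rpow_add Real.pi_pos, Real.rpow_one,
    Real.sqrt_eq_rpow]

namespace BeamSchedule

variable {N : ℕ} (B : BeamSchedule N) (m : Material) (k : Fin N)

/-- The temperature rise caused by the beam of segment `k`, if that beam ran along its straight line
forever and the surface were heated from the time `a` on. It vanishes for `t ≤ a`, because there
the upper limit of integration is the square root of a nonpositive number. -/
noncomputable def potential (a : ℝ) (x : Space) (t : ℝ) : ℝ :=
  B.tempScale m k * kernelIntegral (B.vxBar m k) (B.vyBar m k)
    (B.lengthBar k (x 0 - B.startX k - B.vx k * (t - B.ti k)))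
    (B.lengthBar k (x 1 - B.startY k - B.vy k * (t - B.ti k)))
    (B.lengthBar k (x 2)) (B.timeBar m k (t - a))

/-- The surface flux of the beam of segment `k`, continued along its straight line for all times. -/
noncomputable def lineFlux (x y t : ℝ) : ℝ :=
  B.power k / (2 * Real.pi * B.spot k ^ 2) *
    Real.exp (-(((x - (B.startX k + B.vx k * (t - B.ti k))) ^ 2
      + (y - (B.startY k + B.vy k * (t - B.ti k))) ^ 2) / (2 * B.spot k ^ 2)))

theorem fluxFormula_eq_potential (x : Space) (t : ℝ) :
    B.fluxFormula m k x t = B.potential m k (B.ti k) x t := rfl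

theorem _root_.BeamHeat.Material.diffusivity_pos (m : Material) : 0 < m.diffusivity :=
  div_pos m.conductivity_pos (mul_pos m.density_pos m.heatCapacity_pos)

theorem timeBar_nonneg (τ : ℝ) : 0 ≤ B.timeBar m k τ :=
  div_nonneg (Real.sqrt_nonneg _) (B.spot_pos k).le

theorem timeBar_pos {τ : ℝ} (h : 0 < τ) : 0 < B.timeBar m k τ := by
  have := m.diffusivity_pos
  exact div_pos (Real.sqrt_pos.2 (by positivity)) (B.spot_pos k)

theorem timeBar_of_nonpos {τ : ℝ} (h : τ ≤ 0) : B.timeBar m k τ = 0 := by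
  have := m.diffusivity_pos
  rw [timeBar, Real.sqrt_eq_zero_of_nonpos (by nlinarith), zero_div]

theorem timeBar_mono : Monotone (B.timeBar m k) := fun a b h => by
  have h1 := m.diffusivity_pos
  have h2 := B.spot_pos k
  unfold timeBar
  gcongr

theorem timeBar_sq {τ : ℝ} (h : 0 ≤ τ) :
    B.timeBar m k τ ^ 2 = 2 * m.diffusivity * τ / B.spot k ^ 2 := by
  have := m.diffusivity_pos
  rw [timeBar, div_pow, Real.sq_sqrt (by positivity)]

theorem hasDerivAt_timeBar {τ : ℝ} (h : 0 < τ) :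
    HasDerivAt (B.timeBar m k) (m.diffusivity / (B.spot k ^ 2 * B.timeBar m k τ)) τ := by
  have h1 := m.diffusivity_pos
  have h2 := B.spot_pos k
  have h3 : HasDerivAt (fun τ => 2 * m.diffusivity * τ) (2 * m.diffusivity) τ := by
    simpa using (hasDerivAt_id τ).const_mul (2 * m.diffusivity)
  have h4 : 0 < √(2 * m.diffusivity * τ) := Real.sqrt_pos.2 (by positivity)
  refine ((h3.sqrt (by positivity)).div_const (B.spot k)).congr_deriv ?_
  unfold timeBar
  field_simp

theorem potential_of_le {a t : ℝ} (h : t ≤ a) (x : Space) : B.potential m k a x t = 0 := by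
  rw [potential, timeBar_of_nonpos _ _ _ (by linarith), kernelIntegral,
    intervalIntegral.integral_same, mul_zero]

theorem lengthBar_ne_zero {l : ℝ} (h : l ≠ 0) : B.lengthBar k l ≠ 0 := by
  have := B.spot_pos k
  unfold lengthBar; positivity

theorem lengthBar_add (l h : ℝ) :
    B.lengthBar k (l + h) = B.lengthBar k l + 1 / (√2 * B.spot k) * h := by
  unfold lengthBar; ring

theorem continuous_potential (a : ℝ) :
    Continuous fun p : Space × ℝ => B.potential m k a p.1 p.2 := by
  unfold potential
  refine continuous_const.mul ((continuous_kernelIntegral _ _).comp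
    (f := fun p : Space × ℝ => ((B.lengthBar k (p.1 0 - B.startX k - B.vx k * (p.2 - B.ti k)),
      B.lengthBar k (p.1 1 - B.startY k - B.vy k * (p.2 - B.ti k)),
      B.lengthBar k (p.1 2)), B.timeBar m k (p.2 - a))) ?_)
  simp only [lengthBar, timeBar, div_eq_mul_inv]
  fun_prop

theorem abs_potential_le {a : ℝ} (x : Space) (t : ℝ) :
    |B.potential m k a x t| ≤ |B.tempScale m k| * B.timeBar m k (t - a) := by
  rw [potential, abs_mul]
  refine mul_le_mul_of_nonneg_left ((abs_kernelIntegral_le ..).trans ?_) (abs_nonneg _)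
  rw [abs_of_nonneg (timeBar_nonneg ..)]

theorem contDiffAt_potential (a : ℝ) {x : Space} (hx : x 2 ≠ 0) (t : ℝ) :
    ContDiffAt ℝ 2 (fun y => B.potential m k a y t) x := by
  unfold potential
  refine contDiffAt_const.mul ?_
  refine ContDiffAt.comp x (g := fun p : ℝ × ℝ × ℝ × ℝ =>
    kernelIntegral (B.vxBar m k) (B.vyBar m k) p.1 p.2.1 p.2.2.1 p.2.2.2)
    (f := fun y : Space => (B.lengthBar k (y 0 - B.startX k - B.vx k * (t - B.ti k)),
      B.lengthBar k (y 1 - B.startY k - B.vy k * (t - B.ti k)),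
      B.lengthBar k (y 2), B.timeBar m k (t - a))) ?_ ?_
  · exact (contDiffOn_kernelIntegral _ _).contDiffAt
      (isOpen_ne_surface.mem_nhds (B.lengthBar_ne_zero k hx))
  · simp only [lengthBar, div_eq_mul_inv]
    fun_prop

theorem laplacian_potential (a : ℝ) {x : Space} (hx : x 2 ≠ 0) (t : ℝ) {X Y Z R : ℝ}
    (hX : X = B.lengthBar k (x 0 - B.startX k - B.vx k * (t - B.ti k)))
    (hY : Y = B.lengthBar k (x 1 - B.startY k - B.vy k * (t - B.ti k)))
    (hZ : Z = B.lengthBar k (x 2)) (hR : R = B.timeBar m k (t - a)) :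
    (Δ fun y => B.potential m k a y t) x = B.tempScale m k * (1 / (√2 * B.spot k)) ^ 2 *
      (kernelIntegralXX (B.vxBar m k) (B.vyBar m k) X Y Z R
        + kernelIntegralXX (B.vyBar m k) (B.vxBar m k) Y X Z R
        + kernelIntegralZZ (B.vxBar m k) (B.vyBar m k) X Y Z R) := by
  have hZ0 : Z ≠ 0 := hZ ▸ B.lengthBar_ne_zero k hx
  rw [laplacian_eq_sum_deriv_deriv (B.contDiffAt_potential m k a hx t), Fin.sum_univ_three]
  have e : ∀ l s h : ℝ, l + h - s = l - s + h := fun l s h => by ring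
  have h0 : (fun h : ℝ => B.potential m k a (x + h • EuclideanSpace.single 0 (1 : ℝ)) t)
      = fun h => B.tempScale m k * kernelIntegral (B.vxBar m k) (B.vyBar m k)
        (X + 1 / (√2 * B.spot k) * h) Y Z R := by
    funext h
    simp [potential, e, lengthBar_add, hX, hY, hZ, hR]
  have h1 : (fun h : ℝ => B.potential m k a (x + h • EuclideanSpace.single 1 (1 : ℝ)) t)
      = fun h => B.tempScale m k * kernelIntegral (B.vyBar m k) (B.vxBar m k)
        (Y + 1 / (√2 * B.spot k) * h) X Z R := by
    funext h
    rw [kernelIntegral_swap]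
    simp [potential, e, lengthBar_add, hX, hY, hZ, hR]
  have h2 : (fun h : ℝ => B.potential m k a (x + h • EuclideanSpace.single 2 (1 : ℝ)) t)
      = fun h => B.tempScale m k * kernelIntegral (B.vxBar m k) (B.vyBar m k)
        X Y (Z + 1 / (√2 * B.spot k) * h) R := by
    funext h
    simp [potential, lengthBar_add, hX, hY, hZ, hR]
  rw [h0, h1, h2,
    deriv_deriv_comp_affine (φ := fun X => kernelIntegral (B.vxBar m k) (B.vyBar m k) X Y Z R)
      (Eventually.of_forall fun X => hasDerivAt_kernelIntegral_x _ _ X Y hZ0 R)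
      (hasDerivAt_kernelIntegralX _ _ X Y hZ0 R),
    deriv_deriv_comp_affine (φ := fun Y => kernelIntegral (B.vyBar m k) (B.vxBar m k) Y X Z R)
      (Eventually.of_forall fun Y => hasDerivAt_kernelIntegral_x _ _ Y X hZ0 R)
      (hasDerivAt_kernelIntegralX _ _ Y X hZ0 R),
    deriv_deriv_comp_affine (φ := fun Z => kernelIntegral (B.vxBar m k) (B.vyBar m k) X Y Z R)
      (by filter_upwards [isOpen_ne.mem_nhds hZ0] with Z hZ using
            hasDerivAt_kernelIntegral_z _ _ X Y hZ R)
      (hasDerivAt_kernelIntegralZ _ _ X Y hZ0 R)]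
  ring

/-- Up to the time at which the beam is switched on, the temperature rise below the surface has
time derivative zero, since afterwards it starts as `O((t - a) ^ (3 / 2))`. -/
theorem hasDerivAt_potential_of_le {a t : ℝ} (h : t ≤ a) {x : Space} (hx : x 2 ≠ 0) :
    HasDerivAt (B.potential m k a x) 0 t := by
  have hκ := m.diffusivity_pos
  have hσ := B.spot_pos k
  rw [hasDerivAt_iff_isLittleO]
  simp only [B.potential_of_le m k h, sub_zero, smul_zero]
  have h1 : B.potential m k a x =O[𝓝 t] fun s => √(2 * m.diffusivity * (s - t)) ^ 3 := by
    refine Asymptotics.IsBigO.of_bound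
      (|B.tempScale m k| * (1 / B.spot k ^ 3 / B.lengthBar k (x 2) ^ 2))
      (Eventually.of_forall fun s => ?_)
    rw [Real.norm_eq_abs, potential, abs_mul, mul_assoc]
    refine mul_le_mul_of_nonneg_left ?_ (abs_nonneg _)
    refine (abs_kernelIntegral_le_cube _ _ _ _ _ (B.lengthBar_ne_zero k hx)
      (timeBar_nonneg ..)).trans ?_
    have h2 : B.timeBar m k (s - a) ≤ B.timeBar m k (s - t) := B.timeBar_mono m k (by linarith)
    have h3 := B.timeBar_nonneg m k (s - a)
    rw [Real.norm_of_nonneg (by positivity)]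
    calc B.timeBar m k (s - a) ^ 3 / B.lengthBar k (x 2) ^ 2
        ≤ B.timeBar m k (s - t) ^ 3 / B.lengthBar k (x 2) ^ 2 := by gcongr
      _ = _ := by rw [timeBar]; field_simp
  refine h1.trans_isLittleO ?_
  have h4 : (fun s : ℝ => √(2 * m.diffusivity * (s - t))) =o[𝓝 t] fun _ => (1 : ℝ) := by
    rw [Asymptotics.isLittleO_one_iff]
    have : Continuous fun s : ℝ => √(2 * m.diffusivity * (s - t)) := by fun_prop
    simpa using this.tendsto t
  have h5 : (fun s : ℝ => √(2 * m.diffusivity * (s - t)) ^ 2) =O[𝓝 t] fun s => s - t := by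
    refine Asymptotics.IsBigO.of_bound (2 * m.diffusivity) (Eventually.of_forall fun s => ?_)
    rw [Real.norm_of_nonneg (by positivity), Real.norm_eq_abs]
    rcases le_total 0 (s - t) with h | h
    · rw [Real.sq_sqrt (by positivity), abs_of_nonneg h]
    · rw [Real.sqrt_eq_zero_of_nonpos (by nlinarith), zero_pow two_ne_zero]
      positivity
  refine (h4.mul_isBigO h5).congr (fun s => by ring) fun s => by ring

/-- The heat equation for the potential. After the switch-on, the drift terms of
`kernelIntegral_heat` come from the motion of the beam centre, and its boundary term comes from the
moving upper limit of integration. -/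
theorem heat_potential (a : ℝ) {x : Space} (hx : x 2 ≠ 0) (t : ℝ) :
    HasDerivAt (B.potential m k a x)
      (m.diffusivity * (Δ fun y => B.potential m k a y t) x) t := by
  have hκ := m.diffusivity_pos
  have hσ := B.spot_pos k
  rcases le_or_gt t a with h | h
  · refine (B.hasDerivAt_potential_of_le m k h hx).congr_deriv ?_
    rw [B.laplacian_potential m k a hx t rfl rfl rfl rfl, B.timeBar_of_nonpos m k (by linarith)]
    simp [kernelIntegralXX, kernelIntegralZZ]
  have hR := B.timeBar_pos m k (sub_pos.2 h)
  have hZ := B.lengthBar_ne_zero k hx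
  have hpos : ∀ l v : ℝ, HasDerivAt (fun t => B.lengthBar k (l - v * (t - B.ti k)))
      (-v / (√2 * B.spot k)) t := fun l v => by
    have := ((((hasDerivAt_id t).sub_const (B.ti k)).const_mul v).const_sub l).div_const
      (√2 * B.spot k)
    exact this.congr_deriv (by simp)
  have hRc : HasDerivAt (fun t => B.timeBar m k (t - a))
      (m.diffusivity / (B.spot k ^ 2 * B.timeBar m k (t - a))) t := by
    simpa using (B.hasDerivAt_timeBar m k (sub_pos.2 h)).comp_sub_const t a
  have h1 := (hasDerivAt_kernelIntegral_curve (B.vxBar m k) (B.vyBar m k)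
    (hpos (x 0 - B.startX k) (B.vx k)) (hpos (x 1 - B.startY k) (B.vy k)) hRc hZ
    hR.ne').const_mul (B.tempScale m k)
  refine h1.congr_deriv ?_
  rw [B.laplacian_potential m k a hx t rfl rfl rfl rfl, kernelIntegral_heat _ _ _ _ hZ hR.ne']
  simp only [vxBar, vyBar]
  have h2 : √2 ^ 2 = (2 : ℝ) := Real.sq_sqrt (by norm_num)
  have h3 : (√2 : ℝ) ≠ 0 := by positivity
  set R := B.timeBar m k (t - a)
  field_simp
  simp only [h2]
  ring

theorem surfaceDerivative_potential {a t : ℝ} {x : Space} (hx : x 2 = 0) (h : a < t) :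
    HasDerivWithinAt
      (fun h : ℝ => B.potential m k a (x + h • EuclideanSpace.single 2 (1 : ℝ)) t)
      (B.lineFlux k (x 0) (x 1) t / m.conductivity) (Iic 0) 0 := by
  have hσ := B.spot_pos k
  have hl := m.conductivity_pos
  have hR := B.timeBar_pos m k (sub_pos.2 h)
  have h1 := hasDerivWithinAt_kernelIntegral_surface (B.vxBar m k) (B.vyBar m k)
    (B.lengthBar k (x 0 - B.startX k - B.vx k * (t - B.ti k)))
    (B.lengthBar k (x 1 - B.startY k - B.vy k * (t - B.ti k))) hR
  have h2 : HasDerivWithinAt (fun h : ℝ => B.lengthBar k h) (1 / (√2 * B.spot k)) (Iic 0) 0 :=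
    ((hasDerivAt_id (0 : ℝ)).div_const (√2 * B.spot k)).hasDerivWithinAt
  have h3 : B.lengthBar k 0 = 0 := by simp [lengthBar]
  rw [← h3] at h1
  have h4 : MapsTo (fun h : ℝ => B.lengthBar k h) (Iic 0) (Iic (B.lengthBar k 0)) :=
    fun h (hh : h ≤ 0) => by
      rw [h3]
      exact div_nonpos_of_nonpos_of_nonneg (b := √2 * B.spot k) hh (by positivity)
  have h5 := (h1.comp (0 : ℝ) h2 h4).const_mul (B.tempScale m k)
  have h6 : (fun h : ℝ => B.potential m k a (x + h • EuclideanSpace.single 2 (1 : ℝ)) t)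
      = fun h => B.tempScale m k * kernelIntegral (B.vxBar m k) (B.vyBar m k)
        (B.lengthBar k (x 0 - B.startX k - B.vx k * (t - B.ti k)))
        (B.lengthBar k (x 1 - B.startY k - B.vy k * (t - B.ti k)))
        (B.lengthBar k h) (B.timeBar m k (t - a)) := by
    funext h
    simp [potential, hx]
  rw [h6]
  refine h5.congr_deriv ?_
  have h7 : √2 ^ 2 = (2 : ℝ) := Real.sq_sqrt (by norm_num)
  have h9 : -(B.lengthBar k (x 0 - B.startX k - B.vx k * (t - B.ti k)) ^ 2
      + B.lengthBar k (x 1 - B.startY k - B.vy k * (t - B.ti k)) ^ 2)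
      = -(((x 0 - (B.startX k + B.vx k * (t - B.ti k))) ^ 2
      + (x 1 - (B.startY k + B.vy k * (t - B.ti k))) ^ 2) / (2 * B.spot k ^ 2)) := by
    simp only [lengthBar, div_pow, mul_pow, h7]
    ring
  rw [lineFlux, tempScale, pi_rpow_three_halves, h9]
  have := Real.pi_pos
  field_simp
  rw [h7]

theorem isBoundedSolution_potential {a : ℝ} (ha : 0 ≤ a) (T : ℝ) :
    IsBoundedSolution m (fun x y t => if a < t then B.lineFlux k x y t else 0) T 0
      (B.potential m k a) where
  continuousOn := (B.continuous_potential m k a).continuousOn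
  bounded := ⟨|B.tempScale m k| * B.timeBar m k (T - a), fun x _ t ht =>
    (B.abs_potential_le m k x t).trans (mul_le_mul_of_nonneg_left
      (B.timeBar_mono m k (by linarith [ht.2])) (abs_nonneg _))⟩
  contDiffAt x hx t _ := B.contDiffAt_potential m k a hx.ne t
  differentiable_time x hx t _ :=
    (B.heat_potential m k a hx.ne t).differentiableAt.differentiableWithinAt
  heat_equation x hx t ht := by
    rw [(B.heat_potential m k a hx.ne t).hasDerivWithinAt.derivWithin
      (IsBoundedSolution.uniqueDiffWithinAt ht), Material.diffusivity]
    have := m.density_pos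
    have := m.heatCapacity_pos
    field_simp
    ring
  surface_flux x hx t _ := by
    split_ifs with h
    · exact ⟨_, B.surfaceDerivative_potential m k hx h,
        mul_div_cancel₀ _ m.conductivity_pos.ne'⟩
    · refine ⟨0, ?_, mul_zero _⟩
      simp only [B.potential_of_le m k (not_lt.1 h)]
      exact hasDerivWithinAt_const _ _ _
  initial x _ := B.potential_of_le m k ha x

end BeamSchedule

end

/-! ### Gaussian integrals -/

theorem integral_gaussian_mul_gaussian (a b : ℝ) {α β : ℝ} (hα : 0 < α) (hβ : 0 < β) :
    ∫ ξ : ℝ, Real.exp (-((a - ξ) ^ 2 / α) - (ξ - b) ^ 2 / β)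
      = √(Real.pi * α * β / (α + β)) * Real.exp (-((a - b) ^ 2 / (α + β))) := by
  have hs : 0 < α + β := by positivity
  have h1 : ∀ ξ : ℝ, Real.exp (-((a - ξ) ^ 2 / α) - (ξ - b) ^ 2 / β)
      = Real.exp (-((α + β) / (α * β)) * (ξ - (a * β + b * α) / (α + β)) ^ 2)
        * Real.exp (-((a - b) ^ 2 / (α + β))) := fun ξ => by
    rw [← Real.exp_add]
    congr 1
    field_simp
    ring
  simp only [h1]
  rw [integral_mul_const,
    integral_sub_right_eq_self (fun ξ : ℝ => Real.exp (-((α + β) / (α * β)) * ξ ^ 2)),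
    integral_gaussian]
  congr 2
  field_simp

theorem lateralIntegral_eq (v x : ℝ) {τ : ℝ} (hτ : 0 < τ) (r : ℝ) :
    lateralIntegral v x τ r = √(Real.pi * τ ^ 2 * (1 + r ^ 2) / (1 + r ^ 2 + τ ^ 2)) *
      Real.exp (-((x + v * r ^ 2) ^ 2 / (1 + r ^ 2 + τ ^ 2))) := by
  have h := integral_gaussian_mul_gaussian x (-(v * r ^ 2)) (pow_pos hτ 2)
    (show 0 < 1 + r ^ 2 by positivity)
  simp only [sub_neg_eq_add] at h
  rw [lateralIntegral, h, add_comm (τ ^ 2)]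

theorem verticalIntegral_eq (z : ℝ) {τ r : ℝ} (hτ : 0 < τ) (hr : 0 < r) :
    verticalIntegral z τ r = √(Real.pi * τ ^ 2 * r ^ 2 / (r ^ 2 + τ ^ 2)) *
      Real.exp (-(z ^ 2 / (r ^ 2 + τ ^ 2))) := by
  have h := integral_gaussian_mul_gaussian z 0 (pow_pos hτ 2) (pow_pos hr 2)
  simp only [sub_zero] at h
  rw [verticalIntegral, h, add_comm (τ ^ 2)]

theorem integral_comp_sub_inv_mul (F : ℝ → ℝ) (a : ℝ) {l : ℝ} (hl : 0 < l) :
    ∫ u : ℝ, F (a - l⁻¹ * u) = l * ∫ u : ℝ, F u := by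
  rw [Measure.integral_comp_mul_left (fun u => F (a - u)) l⁻¹,
    integral_sub_left_eq_self F volume a, inv_inv, abs_of_pos hl, smul_eq_mul]

theorem integral_space_prod (f g h : ℝ → ℝ) :
    ∫ y : Space, f (y 0) * g (y 1) * h (y 2) = (∫ u, f u) * (∫ u, g u) * ∫ u, h u := by
  have h1 := (PiLp.volume_preserving_ofLp (Fin 3)).integral_comp
    (MeasurableEquiv.toLp 2 (Fin 3 → ℝ)).symm.measurableEmbedding
    (fun y : Fin 3 → ℝ => f (y 0) * g (y 1) * h (y 2))
  have h2 := integral_fintype_prod_volume_eq_prod (𝕜 := ℝ) (ι := Fin 3) (E := fun _ => ℝ)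
    ![f, g, h]
  simp only [Fin.prod_univ_three] at h2
  exact h1.trans h2

/-! ### Diffusion by the Green's function -/

theorem integral_green {κ t : ℝ} (hκ : 0 < κ) (ht : 0 < t) : ∫ x : Space, green κ x t = 1 := by
  have hb : 0 < 1 / (4 * κ * t) := by positivity
  have h := GaussianFourier.integral_rexp_neg_mul_sq_norm (V := Space) hb
  have h1 : ∀ x : Space, Real.exp (-(‖x‖ ^ 2 / (4 * κ * t)))
      = Real.exp (-(1 / (4 * κ * t)) * ‖x‖ ^ 2) := fun x => by congr 1; ring
  simp only [green, h1]
  rw [integral_const_mul, h]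
  have h2 := Real.pi_pos
  rw [finrank_euclideanSpace, Fintype.card_fin, Nat.cast_ofNat,
    ← Real.mul_rpow (by positivity) (by positivity),
    show 1 / (4 * Real.pi * κ * t) * (Real.pi / (1 / (4 * κ * t))) = 1 by field_simp,
    Real.one_rpow]

theorem integrable_green {κ t : ℝ} (hκ : 0 < κ) (ht : 0 < t) :
    Integrable fun x : Space => green κ x t :=
  .of_integral_ne_zero (by rw [integral_green hκ ht]; exact one_ne_zero)

theorem diffuse_eq_integral (κ t : ℝ) (f : Space → ℝ) (x : Space) :
    diffuse κ t f x = ∫ y : Space, green κ y t * f (x - y) := by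
  rw [diffuse, convolution_lsmul]
  simp only [smul_eq_mul]

theorem integrable_green_mul {κ t : ℝ} (hκ : 0 < κ) (ht : 0 < t) {f : Space → ℝ} {C : ℝ}
    (hf : Measurable f) (hC : ∀ x, |f x| ≤ C) (x : Space) :
    Integrable fun y : Space => green κ y t * f (x - y) := by
  have := (integrable_green hκ ht).bdd_mul (f := fun y : Space => f (x - y)) (c := C)
    (hf.comp (by fun_prop)).aestronglyMeasurable (Eventually.of_forall fun y => hC (x - y))
  simpa only [mul_comm] using this

theorem diffuse_const_add_sum {κ t : ℝ} (hκ : 0 < κ) (ht : 0 < t) (a : ℝ) {ι : Type*}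
    (s : Finset ι) {f : ι → Space → ℝ} {C : ι → ℝ} (hf : ∀ i ∈ s, Measurable (f i))
    (hC : ∀ i ∈ s, ∀ x, |f i x| ≤ C i) (x : Space) :
    diffuse κ t (fun ξ => a + ∑ i ∈ s, f i ξ) x = a + ∑ i ∈ s, diffuse κ t (f i) x := by
  simp only [diffuse_eq_integral, mul_add, Finset.mul_sum]
  have h1 : ∀ i ∈ s, Integrable fun y : Space => green κ y t * f i (x - y) := fun i hi =>
    integrable_green_mul hκ ht (hf i hi) (hC i hi) x
  rw [integral_add ((integrable_green hκ ht).mul_const a) (integrable_finsetSum s h1),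
    integral_finsetSum s h1, integral_mul_const, integral_green hκ ht, one_mul]

/-- Diffusion commutes with the integration over a parameter, by Fubini's theorem. -/
theorem diffuse_intervalIntegral {κ t : ℝ} (hκ : 0 < κ) (ht : 0 < t) {q : Space → ℝ → ℝ}
    (hq : Measurable fun p : Space × ℝ => q p.1 p.2) {C : ℝ} (hC : ∀ x r, |q x r| ≤ C)
    (A α β : ℝ) (x : Space) :
    diffuse κ t (fun ξ => A * ∫ r in α..β, q ξ r) x
      = A * ∫ r in α..β, ∫ y : Space, green κ y t * q (x - y) r := by
  have hint : ∀ a b : ℝ, Integrable (Function.uncurry fun (y : Space) (r : ℝ) =>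
      green κ y t * q (x - y) r) (volume.prod (volume.restrict (Ioc a b))) := fun a b => by
    have h1 : Integrable (fun z : Space × ℝ => green κ z.1 t * (1 : ℝ))
        (volume.prod (volume.restrict (Ioc a b))) :=
      (integrable_green hκ ht).mul_prod (integrable_const (1 : ℝ))
    simp only [mul_one] at h1
    have h2 := h1.bdd_mul (f := fun z : Space × ℝ => q (x - z.1) z.2) (c := C)
      (hq.comp (f := fun z : Space × ℝ => (x - z.1, z.2)) (by fun_prop)).aestronglyMeasurable
      (Eventually.of_forall fun z => hC _ _)
    simpa only [mul_comm, Function.uncurry_def] using h2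
  rw [diffuse_eq_integral]
  have h3 : ∀ y : Space, green κ y t * (A * ∫ r in α..β, q (x - y) r)
      = A * ∫ r in α..β, green κ y t * q (x - y) r := fun y => by
    rw [intervalIntegral.integral_const_mul]; ring
  simp only [h3]
  rw [integral_const_mul]
  congr 1
  simp only [intervalIntegral]
  have j : ∀ a b : ℝ, Integrable fun y : Space => ∫ r in Ioc a b, green κ y t * q (x - y) r :=
    fun a b => (hint a b).integral_prod_left
  rw [integral_sub (j α β) (j β α),
    integral_integral_swap (hint α β), integral_integral_swap (hint β α)]

theorem one_div_pi_mul_sq_rpow {b : ℝ} (hb : 0 < b) :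
    (1 / (Real.pi * b ^ 2)) ^ (3 / 2 : ℝ) = 1 / (Real.pi ^ (3 / 2 : ℝ) * b ^ 3) := by
  have := Real.pi_pos
  rw [Real.div_rpow zero_le_one (by positivity), Real.one_rpow,
    Real.mul_rpow this.le (by positivity), ← Real.rpow_natCast b 2, ← Real.rpow_mul hb.le,
    ← Real.rpow_natCast b 3]
  norm_num

/-- The kernel after diffusion by the dimensionless time `τ ^ 2`: its variable is shifted from `r ^ 2`
to `r ^ 2 + τ ^ 2`, and there is a Jacobian factor. -/
noncomputable def diffusedKernel (V W X Y Z τ r : ℝ) : ℝ :=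
  r * (r ^ 2 + τ ^ 2) ^ (-(1 / 2) : ℝ) / (1 + r ^ 2 + τ ^ 2) *
    Real.exp (-(((X + V * r ^ 2) ^ 2 + (Y + W * r ^ 2) ^ 2) / (1 + r ^ 2 + τ ^ 2))
      - Z ^ 2 / (r ^ 2 + τ ^ 2))

theorem gaussianIntegrals_eq_diffusedKernel (V W X Y Z : ℝ) {τ r : ℝ} (hτ : 0 < τ) (hr : 0 < r) :
    1 / (Real.pi ^ (3 / 2 : ℝ) * τ ^ 3) * (1 / (1 + r ^ 2) * lateralIntegral V X τ r *
      lateralIntegral W Y τ r * verticalIntegral Z τ r) = diffusedKernel V W X Y Z τ r := by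
  have hπ := Real.pi_pos
  have h2 : (r ^ 2 + τ ^ 2) ^ (-(1 / 2) : ℝ) = 1 / √(r ^ 2 + τ ^ 2) := by
    rw [Real.rpow_neg (by positivity), Real.sqrt_eq_rpow, one_div (_ ^ _)]
  have h3 : √(Real.pi * τ ^ 2 * r ^ 2 / (r ^ 2 + τ ^ 2))
      = √Real.pi * τ * r / √(r ^ 2 + τ ^ 2) := by
    rw [Real.sqrt_div (by positivity), Real.sqrt_mul (by positivity), Real.sqrt_mul hπ.le,
      Real.sqrt_sq hτ.le, Real.sqrt_sq hr.le]
  rw [lateralIntegral_eq _ _ hτ, lateralIntegral_eq _ _ hτ, verticalIntegral_eq _ hτ hr,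
    diffusedKernel, pi_rpow_three_halves, h2, h3]
  have h4 : √(Real.pi * τ ^ 2 * (1 + r ^ 2) / (1 + r ^ 2 + τ ^ 2)) *
      √(Real.pi * τ ^ 2 * (1 + r ^ 2) / (1 + r ^ 2 + τ ^ 2))
      = Real.pi * τ ^ 2 * (1 + r ^ 2) / (1 + r ^ 2 + τ ^ 2) := Real.mul_self_sqrt (by positivity)
  have h5 : Real.exp (-(((X + V * r ^ 2) ^ 2 + (Y + W * r ^ 2) ^ 2) / (1 + r ^ 2 + τ ^ 2))
      - Z ^ 2 / (r ^ 2 + τ ^ 2)) = Real.exp (-((X + V * r ^ 2) ^ 2 / (1 + r ^ 2 + τ ^ 2)))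
      * Real.exp (-((Y + W * r ^ 2) ^ 2 / (1 + r ^ 2 + τ ^ 2)))
      * Real.exp (-(Z ^ 2 / (r ^ 2 + τ ^ 2))) := by
    rw [← Real.exp_add, ← Real.exp_add]
    congr 1
    ring
  rw [h5]
  generalize Real.exp (-((X + V * r ^ 2) ^ 2 / (1 + r ^ 2 + τ ^ 2))) = E₁
  generalize Real.exp (-((Y + W * r ^ 2) ^ 2 / (1 + r ^ 2 + τ ^ 2))) = E₂
  generalize Real.exp (-(Z ^ 2 / (r ^ 2 + τ ^ 2))) = E₃
  set s := √(Real.pi * τ ^ 2 * (1 + r ^ 2) / (1 + r ^ 2 + τ ^ 2))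
  have h6 : 1 / (Real.pi * √Real.pi * τ ^ 3) * (1 / (1 + r ^ 2) * (s * E₁) * (s * E₂) *
      (√Real.pi * τ * r / √(r ^ 2 + τ ^ 2) * E₃))
      = 1 / (Real.pi * √Real.pi * τ ^ 3) * (1 / (1 + r ^ 2) * (s * s) *
      (√Real.pi * τ * r / √(r ^ 2 + τ ^ 2))) * (E₁ * E₂ * E₃) := by ring
  rw [h6, h4]
  field_simp

/-- The substitution `w ^ 2 = r ^ 2 + τ ^ 2` in the integral of the diffused kernel. -/
theorem integral_diffusedKernel (V W X Y Z : ℝ) {τ α β : ℝ} (hτ : 0 < τ) :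
    ∫ r in α..β, diffusedKernel V W X Y Z τ r
      = ∫ w in √(α ^ 2 + τ ^ 2)..√(β ^ 2 + τ ^ 2),
        kernel V W (X - V * τ ^ 2) (Y - W * τ ^ 2) Z w := by
  have hpos : ∀ r : ℝ, 0 < r ^ 2 + τ ^ 2 := fun r => by positivity
  have hne : ∀ w : ℝ, 1 + w ^ 2 ≠ 0 := fun w => by positivity
  rw [← intervalIntegral.integral_comp_mul_deriv' (f := fun r => √(r ^ 2 + τ ^ 2))
    (f' := fun r => r / √(r ^ 2 + τ ^ 2))]
  · refine intervalIntegral.integral_congr fun r _ => ?_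
    have h1 : √(r ^ 2 + τ ^ 2) ^ 2 = r ^ 2 + τ ^ 2 := Real.sq_sqrt (hpos r).le
    simp only [Function.comp, kernel, diffusedKernel, h1]
    rw [Real.rpow_neg (hpos r).le, Real.sqrt_eq_rpow, ← add_assoc,
      show X - V * τ ^ 2 + V * (r ^ 2 + τ ^ 2) = X + V * r ^ 2 by ring,
      show Y - W * τ ^ 2 + W * (r ^ 2 + τ ^ 2) = Y + W * r ^ 2 by ring]
    ring
  · intro r _
    refine ((((hasDerivAt_pow 2 r).add_const (τ ^ 2)).sqrt (hpos r).ne')).congr_deriv ?_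
    have := Real.sqrt_pos.2 (hpos r)
    field_simp
    simp
  · have : ∀ r : ℝ, √(r ^ 2 + τ ^ 2) ≠ 0 := fun r => (Real.sqrt_pos.2 (hpos r)).ne'
    refine Continuous.continuousOn ?_
    fun_prop (disch := simp [this])
  · rintro _ ⟨r, _, rfl⟩
    have h2 : √(r ^ 2 + τ ^ 2) ^ 2 ≠ 0 := (pow_pos (Real.sqrt_pos.2 (hpos r)) 2).ne'
    refine ContinuousAt.continuousWithinAt ?_
    unfold kernel
    have h3 := hne √(r ^ 2 + τ ^ 2)
    fun_prop (disch := assumption)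

namespace BeamSchedule

variable {N : ℕ} (B : BeamSchedule N) (m : Material) (k : Fin N)

theorem green_eq (x : Space) {θ : ℝ} (hθ : 0 < θ) :
    green m.diffusivity x θ
      = 1 / (Real.pi ^ (3 / 2 : ℝ) * (√2 * B.spot k * B.timeBar m k θ) ^ 3) *
        Real.exp (-((x 0 ^ 2 + x 1 ^ 2 + x 2 ^ 2) / (√2 * B.spot k * B.timeBar m k θ) ^ 2)) := by
  have hσ := B.spot_pos k
  have hκ := m.diffusivity_pos
  have hτ := B.timeBar_pos m k hθ
  have h1 : (√2 * B.spot k * B.timeBar m k θ) ^ 2 = 4 * m.diffusivity * θ := by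
    rw [mul_pow, mul_pow, B.timeBar_sq m k hθ.le, Real.sq_sqrt (by norm_num)]
    field_simp
    ring
  rw [← one_div_pi_mul_sq_rpow (by positivity), h1, green, EuclideanSpace.norm_sq_eq,
    Fin.sum_univ_three]
  simp only [Real.norm_eq_abs, sq_abs]
  congr 3
  ring

/-- The integral over space splits into three one-dimensional ones, each of which takes its
dimensionless form by `ξ = (a - u) / (√2 σ)`. -/
theorem integral_green_mul_kernel (V W c₀ c₁ : ℝ) (x : Space) {θ : ℝ} (hθ : 0 < θ) (r : ℝ) :
    ∫ y : Space, green m.diffusivity y θ * kernel V W (B.lengthBar k (x 0 - y 0 - c₀))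
        (B.lengthBar k (x 1 - y 1 - c₁)) (B.lengthBar k (x 2 - y 2)) r
      = 1 / (Real.pi ^ (3 / 2 : ℝ) * B.timeBar m k θ ^ 3) * (1 / (1 + r ^ 2) *
        lateralIntegral V (B.lengthBar k (x 0 - c₀)) (B.timeBar m k θ) r *
        lateralIntegral W (B.lengthBar k (x 1 - c₁)) (B.timeBar m k θ) r *
        verticalIntegral (B.lengthBar k (x 2)) (B.timeBar m k θ) r) := by
  have hσ := B.spot_pos k
  have hτ := B.timeBar_pos m k hθ
  have hl : 0 < √2 * B.spot k := by positivity
  set τ := B.timeBar m k θ with hτd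
  set l := √2 * B.spot k with hld
  have hlen : ∀ a : ℝ, B.lengthBar k a = a / l := fun a => rfl
  have hlat : ∀ (V a c : ℝ), ∫ u : ℝ, Real.exp (-(u ^ 2 / (l * τ) ^ 2)
      - (B.lengthBar k (a - u - c) + V * r ^ 2) ^ 2 / (1 + r ^ 2))
      = l * lateralIntegral V (B.lengthBar k (a - c)) τ r := fun V a c => by
    rw [lateralIntegral, ← integral_comp_sub_inv_mul _ (B.lengthBar k (a - c)) hl]
    congr 1
    funext u
    simp only [hlen]
    congr 2
    · field_simp
      ring
    · field_simp
      ring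
  have hver : ∀ a : ℝ, ∫ u : ℝ, Real.exp (-(u ^ 2 / (l * τ) ^ 2)
      - B.lengthBar k (a - u) ^ 2 / r ^ 2)
      = l * verticalIntegral (B.lengthBar k a) τ r := fun a => by
    rw [verticalIntegral, ← integral_comp_sub_inv_mul _ (B.lengthBar k a) hl]
    congr 1
    funext u
    simp only [hlen]
    congr 2
    · field_simp
      ring
    · congr 1
      field_simp
  have h1 : ∀ y : Space, green m.diffusivity y θ * kernel V W (B.lengthBar k (x 0 - y 0 - c₀))
        (B.lengthBar k (x 1 - y 1 - c₁)) (B.lengthBar k (x 2 - y 2)) r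
      = 1 / (Real.pi ^ (3 / 2 : ℝ) * (l * τ) ^ 3) * (1 / (1 + r ^ 2)) *
        (Real.exp (-(y 0 ^ 2 / (l * τ) ^ 2)
          - (B.lengthBar k (x 0 - y 0 - c₀) + V * r ^ 2) ^ 2 / (1 + r ^ 2)) *
        Real.exp (-(y 1 ^ 2 / (l * τ) ^ 2)
          - (B.lengthBar k (x 1 - y 1 - c₁) + W * r ^ 2) ^ 2 / (1 + r ^ 2)) *
        Real.exp (-(y 2 ^ 2 / (l * τ) ^ 2) - B.lengthBar k (x 2 - y 2) ^ 2 / r ^ 2)) := by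
    intro y
    rw [B.green_eq m k y hθ, kernel, ← Real.exp_add, ← Real.exp_add]
    rw [mul_mul_mul_comm, ← Real.exp_add]
    congr 2
    ring
  simp only [h1]
  rw [integral_const_mul, integral_space_prod
    (fun u => Real.exp (-(u ^ 2 / (l * τ) ^ 2)
      - (B.lengthBar k (x 0 - u - c₀) + V * r ^ 2) ^ 2 / (1 + r ^ 2)))
    (fun u => Real.exp (-(u ^ 2 / (l * τ) ^ 2)
      - (B.lengthBar k (x 1 - u - c₁) + W * r ^ 2) ^ 2 / (1 + r ^ 2)))
    (fun u => Real.exp (-(u ^ 2 / (l * τ) ^ 2) - B.lengthBar k (x 2 - u) ^ 2 / r ^ 2)),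
    hlat, hlat, hver]
  have := Real.rpow_pos_of_pos Real.pi_pos (3 / 2)
  field_simp

/-! ### The flux term -/

theorem ti_lt_tf : B.ti k < B.tf k := B.time_strictMono Fin.castSucc_lt_succ

theorem ti_nonneg : 0 ≤ B.ti k := by
  rw [← B.time_zero]
  exact B.time_strictMono.monotone (Fin.zero_le _)

theorem tf_le_ti {k n : Fin N} (h : k < n) : B.tf k ≤ B.ti n :=
  B.time_strictMono.monotone (Fin.succ_le_castSucc_iff.2 h)

theorem tf_le_endTime : B.tf k ≤ B.endTime := B.time_strictMono.monotone (Fin.le_last _)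

theorem flux_eq_lineFlux {t : ℝ} (ht : t ∈ B.segment k) (x y : ℝ) :
    B.flux x y t = B.lineFlux k x y t := by
  rw [flux, lineFlux, powerAt, spotAt, centerX, centerY, B.piecewise_eq _ k ht,
    B.piecewise_eq _ k ht, B.piecewise_eq _ k ht, B.piecewise_eq _ k ht]

/-- The heat supplied at one moment, spread by the Green's function: two one-dimensional Gaussian
integrals over the surface give the kernel, up to a factor that is singular at zero elapsed time. -/
theorem integral_green_mul_lineFlux (x : Space) {s θ r : ℝ} (hθ : 0 < θ)
    (hr : r = B.timeBar m k θ) :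
    ∫ p : ℝ × ℝ, green m.diffusivity !₂[x 0 - p.1, x 1 - p.2, x 2] θ * B.lineFlux k p.1 p.2 s
      = B.power k / (2 * Real.pi * B.spot k ^ 2 * (√2 * B.spot k * √Real.pi * r)) *
        kernel (B.vxBar m k) (B.vyBar m k)
          (B.lengthBar k (x 0 - B.startX k - B.vx k * (s + θ - B.ti k)))
          (B.lengthBar k (x 1 - B.startY k - B.vy k * (s + θ - B.ti k)))
          (B.lengthBar k (x 2)) r := by
  have hσ := B.spot_pos k
  have hκ := m.diffusivity_pos
  have hπ := Real.pi_pos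
  have hr0 : 0 < r := hr ▸ B.timeBar_pos m k hθ
  have hrsq : r ^ 2 = 2 * m.diffusivity * θ / B.spot k ^ 2 := hr ▸ B.timeBar_sq m k hθ.le
  have h2 : (√2 : ℝ) ^ 2 = 2 := Real.sq_sqrt (by norm_num)
  set l := √2 * B.spot k with hl
  have hl0 : 0 < l := by positivity
  have hl2 : l ^ 2 = 2 * B.spot k ^ 2 := by rw [hl, mul_pow, h2]
  set c₀ := B.startX k + B.vx k * (s - B.ti k) with hc₀
  set c₁ := B.startY k + B.vy k * (s - B.ti k) with hc₁
  have hshift : ∀ a b v : ℝ, B.lengthBar k (a - b - v * (s + θ - B.ti k))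
      + v * B.spot k / (2 * √2 * m.diffusivity) * r ^ 2 = (a - (b + v * (s - B.ti k))) / l := by
    intro a b v
    rw [lengthBar, hrsq, hl]
    field_simp
    ring
  have h1 : ∀ p : ℝ × ℝ,
      green m.diffusivity !₂[x 0 - p.1, x 1 - p.2, x 2] θ * B.lineFlux k p.1 p.2 s
      = 1 / (Real.pi ^ (3 / 2 : ℝ) * (l * r) ^ 3) * (B.power k / (2 * Real.pi * B.spot k ^ 2)) *
        Real.exp (-(x 2 ^ 2 / (l * r) ^ 2)) *
        (Real.exp (-((x 0 - p.1) ^ 2 / (l * r) ^ 2) - (p.1 - c₀) ^ 2 / l ^ 2) *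
          Real.exp (-((x 1 - p.2) ^ 2 / (l * r) ^ 2) - (p.2 - c₁) ^ 2 / l ^ 2)) := fun p => by
    rw [B.green_eq m k _ hθ, ← hr, lineFlux, mul_mul_mul_comm, ← Real.exp_add, mul_assoc _ _
      (_ * _), ← Real.exp_add, ← Real.exp_add, hl2]
    congr 2
    simp [hc₀, hc₁, ← hl]
    ring
  simp only [h1]
  rw [integral_const_mul, Measure.volume_eq_prod, integral_prod_mul
    (fun u => Real.exp (-((x 0 - u) ^ 2 / (l * r) ^ 2) - (u - c₀) ^ 2 / l ^ 2))
    (fun u => Real.exp (-((x 1 - u) ^ 2 / (l * r) ^ 2) - (u - c₁) ^ 2 / l ^ 2)),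
    integral_gaussian_mul_gaussian _ _ (by positivity) (by positivity),
    integral_gaussian_mul_gaussian _ _ (by positivity) (by positivity)]
  have h4 := Real.mul_self_sqrt (x := Real.pi * (l * r) ^ 2 * l ^ 2 / ((l * r) ^ 2 + l ^ 2))
    (by positivity)
  set S := √(Real.pi * (l * r) ^ 2 * l ^ 2 / ((l * r) ^ 2 + l ^ 2))
  rw [kernel, vxBar, vyBar, hshift, hshift, ← hc₀, ← hc₁, pi_rpow_three_halves]
  have h5 : Real.exp (-((((x 0 - c₀) / l) ^ 2 + ((x 1 - c₁) / l) ^ 2) / (1 + r ^ 2))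
      - B.lengthBar k (x 2) ^ 2 / r ^ 2)
      = Real.exp (-(x 2 ^ 2 / (l * r) ^ 2)) *
        (Real.exp (-((x 0 - c₀) ^ 2 / ((l * r) ^ 2 + l ^ 2))) *
        Real.exp (-((x 1 - c₁) ^ 2 / ((l * r) ^ 2 + l ^ 2)))) := by
    rw [← Real.exp_add, ← Real.exp_add, lengthBar, ← hl]
    congr 1
    have : (l * r) ^ 2 + l ^ 2 = l ^ 2 * (1 + r ^ 2) := by ring
    rw [this]
    field_simp
    ring
  rw [h5]
  generalize Real.exp (-(x 2 ^ 2 / (l * r) ^ 2)) = E₀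
  generalize Real.exp (-((x 0 - c₀) ^ 2 / ((l * r) ^ 2 + l ^ 2))) = E₁
  generalize Real.exp (-((x 1 - c₁) ^ 2 / ((l * r) ^ 2 + l ^ 2))) = E₂
  rw [show ∀ a : ℝ, a * E₀ * (S * E₁ * (S * E₂)) = a * (S * S) * (E₀ * (E₁ * E₂)) from
    fun a => by ring, h4]
  have : (l * r) ^ 2 + l ^ 2 = l ^ 2 * (1 + r ^ 2) := by ring
  rw [this]
  field_simp

/-- The dimensionless form of the flux term, by the substitution `t - s = σ² r² / (2 κ)`. -/
theorem fluxTerm_eq_fluxFormula {t : ℝ} (ht : t ∈ B.segment k) (x : Space) :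
    B.fluxTerm m k x t = B.fluxFormula m k x t := by
  have hσ := B.spot_pos k
  have hκ := m.diffusivity_pos
  have hπ := Real.pi_pos
  set R := B.timeBar m k (t - B.ti k) with hR
  have hR0 : 0 < R := B.timeBar_pos m k (sub_pos.2 ht.1)
  have hRsq : R ^ 2 = 2 * m.diffusivity * (t - B.ti k) / B.spot k ^ 2 :=
    B.timeBar_sq m k (sub_pos.2 ht.1).le
  set c := B.spot k ^ 2 / (2 * m.diffusivity) with hc
  have hc0 : 0 < c := by positivity
  have hcR : c * R ^ 2 = t - B.ti k := by rw [hRsq, hc]; field_simp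
  have hbar : ∀ r, 0 < r → r = B.timeBar m k (c * r ^ 2) := fun r hr => by
    rw [timeBar, hc, show 2 * m.diffusivity * (B.spot k ^ 2 / (2 * m.diffusivity) * r ^ 2)
      = (B.spot k * r) ^ 2 by field_simp, Real.sqrt_sq (by positivity)]
    field_simp
  have himg : (fun r => t - c * r ^ 2) '' Ioo 0 R = Ioo (B.ti k) t := by
    ext s
    constructor
    · rintro ⟨r, hr, rfl⟩
      have h1 : c * r ^ 2 < c * R ^ 2 := by
        have := hr.1; have := hr.2; gcongr
      have h2 : 0 < c * r ^ 2 := by have := hr.1; positivity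
      constructor <;> simp only <;> linarith
    · intro hs
      have h1 : 0 < (t - s) / c := div_pos (by linarith [hs.2]) hc0
      refine ⟨√((t - s) / c), ⟨Real.sqrt_pos.2 h1, ?_⟩, ?_⟩
      · rw [Real.sqrt_lt' hR0, div_lt_iff₀ hc0]
        linarith [hs.1]
      · simp only
        rw [Real.sq_sqrt h1.le]
        field_simp
        ring
  have hinj : InjOn (fun r : ℝ => t - c * r ^ 2) (Ioo 0 R) := fun a ha b hb hab => by
    simp only [sub_right_inj] at hab
    exact (pow_left_inj₀ ha.1.le hb.1.le two_ne_zero).1 (mul_left_cancel₀ hc0.ne' hab)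
  rw [fluxTerm, intervalIntegral.integral_of_le ht.1.le, integral_Ioc_eq_integral_Ioo, ← himg,
    integral_image_eq_integral_abs_deriv_smul (f' := fun r => -(c * (2 * r))) measurableSet_Ioo
      (fun r _ => by
        have := ((hasDerivAt_pow 2 r).const_mul c).const_sub t
        exact (this.congr_deriv (by simp)).hasDerivWithinAt) hinj]
  have hcongr : ∀ r ∈ Ioo 0 R, |(-(c * (2 * r)))| • (∫ p : ℝ × ℝ,
      green m.diffusivity !₂[x 0 - p.1, x 1 - p.2, x 2] (t - (t - c * r ^ 2)) *
        B.flux p.1 p.2 (t - c * r ^ 2))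
      = c * B.power k / (Real.pi * B.spot k ^ 2 * (√2 * B.spot k * √Real.pi)) *
        kernel (B.vxBar m k) (B.vyBar m k)
          (B.lengthBar k (x 0 - B.startX k - B.vx k * (t - B.ti k)))
          (B.lengthBar k (x 1 - B.startY k - B.vy k * (t - B.ti k)))
          (B.lengthBar k (x 2)) r := fun r hr => by
    have hr0 := hr.1
    have hs : t - c * r ^ 2 ∈ Ioo (B.ti k) t := himg ▸ mem_image_of_mem _ hr
    have hseg : t - c * r ^ 2 ∈ B.segment k := ⟨hs.1, hs.2.le.trans ht.2⟩
    simp only [B.flux_eq_lineFlux k hseg, sub_sub_cancel]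
    rw [B.integral_green_mul_lineFlux m k x (by positivity) (hbar r hr0), sub_add_cancel, abs_neg,
      abs_of_pos (by positivity), smul_eq_mul]
    field_simp
  rw [setIntegral_congr_fun measurableSet_Ioo hcongr, integral_const_mul,
    ← integral_Ioc_eq_integral_Ioo, ← intervalIntegral.integral_of_le hR0.le,
    fluxFormula_eq_potential, potential, kernelIntegral, ← hR, ← mul_assoc]
  congr 1
  have h4 := m.density_pos
  have h5 := m.heatCapacity_pos
  have h6 := m.conductivity_pos
  rw [tempScale, pi_rpow_three_halves, hc, Material.diffusivity]
  field_simp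

/-! ### The temperature rise caused by one segment -/

/-- The temperature rise caused by the beam during segment `k`: the beam is switched on at the time
`ti k`, and its continuation after `tf k` is subtracted. -/
noncomputable def rise (x : Space) (t : ℝ) : ℝ :=
  B.potential m k (B.ti k) x t - B.potential m k (B.tf k) x t

theorem measurable_rise (t : ℝ) : Measurable fun x => B.rise m k x t :=
  (((B.continuous_potential m k _).sub (B.continuous_potential m k _)).comp
    (f := fun x : Space => (x, t)) (by fun_prop)).measurable

theorem abs_rise_le (x : Space) (t : ℝ) :
    |B.rise m k x t| ≤ |B.tempScale m k| * B.timeBar m k (t - B.ti k)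
      + |B.tempScale m k| * B.timeBar m k (t - B.tf k) :=
  (abs_sub _ _).trans (add_le_add (B.abs_potential_le m k x t) (B.abs_potential_le m k x t))

theorem rise_of_le_ti {t : ℝ} (h : t ≤ B.ti k) (x : Space) : B.rise m k x t = 0 := by
  rw [rise, B.potential_of_le m k h, B.potential_of_le m k (h.trans (B.ti_lt_tf k).le), sub_zero]

theorem rise_of_le_tf {t : ℝ} (h : t ≤ B.tf k) (x : Space) :
    B.rise m k x t = B.fluxFormula m k x t := by
  rw [rise, B.potential_of_le m k h, sub_zero, fluxFormula_eq_potential]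

theorem rise_even (x : Space) (t : ℝ) : B.rise m k !₂[x 0, x 1, -|x 2|] t = B.rise m k x t := by
  have h : ∀ V W X Y R : ℝ, kernelIntegral V W X Y (B.lengthBar k (-|x 2|)) R
      = kernelIntegral V W X Y (B.lengthBar k (x 2)) R := fun V W X Y R => by
    rcases abs_cases (x 2) with h | h
    · rw [h.1, show B.lengthBar k (-(x 2)) = -B.lengthBar k (x 2) from neg_div _ _]
      simp only [kernelIntegral, kernel_neg_z]
    · rw [h.1, neg_neg]
  simp [rise, potential, h]

theorem rise_eq_integral (x : Space) (t : ℝ) :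
    B.rise m k x t = B.tempScale m k *
      ∫ r in B.timeBar m k (t - B.tf k)..B.timeBar m k (t - B.ti k),
        kernel (B.vxBar m k) (B.vyBar m k)
          (B.lengthBar k (x 0 - (B.startX k + B.vx k * (t - B.ti k))))
          (B.lengthBar k (x 1 - (B.startY k + B.vy k * (t - B.ti k))))
          (B.lengthBar k (x 2)) r := by
  rw [rise, potential, potential, ← mul_sub]
  simp only [sub_sub]
  rw [kernelIntegral, kernelIntegral, intervalIntegral.integral_interval_sub_left
    (intervalIntegrable_kernel ..) (intervalIntegrable_kernel ..)]

theorem diffuse_rise_eq_integral {t θ : ℝ} (hθ : 0 < θ) (x : Space) :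
    diffuse m.diffusivity θ (fun ξ => B.rise m k ξ t) x = B.tempScale m k *
      ∫ r in B.timeBar m k (t - B.tf k)..B.timeBar m k (t - B.ti k),
        diffusedKernel (B.vxBar m k) (B.vyBar m k)
          (B.lengthBar k (x 0 - (B.startX k + B.vx k * (t - B.ti k))))
          (B.lengthBar k (x 1 - (B.startY k + B.vy k * (t - B.ti k))))
          (B.lengthBar k (x 2)) (B.timeBar m k θ) r := by
  simp only [rise_eq_integral]
  rw [diffuse_intervalIntegral m.diffusivity_pos hθ (C := 1) ?_ fun ξ r => norm_kernel_le_one ..]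
  · congr 1
    refine intervalIntegral.integral_congr_ae (Eventually.of_forall fun r hr => ?_)
    rw [uIoc_of_le (B.timeBar_mono m k (by linarith [B.ti_lt_tf k]))] at hr
    have hr0 : 0 < r := (B.timeBar_nonneg m k _).trans_lt hr.1
    rw [← gaussianIntegrals_eq_diffusedKernel _ _ _ _ _ (B.timeBar_pos m k hθ) hr0,
      ← B.integral_green_mul_kernel m k _ _ _ _ x hθ r]
    rfl
  · refine (measurable_kernel _ _).comp (f := fun p : Space × ℝ =>
      (B.lengthBar k (p.1 0 - (B.startX k + B.vx k * (t - B.ti k))),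
        B.lengthBar k (p.1 1 - (B.startY k + B.vy k * (t - B.ti k))),
        B.lengthBar k (p.1 2), p.2)) ?_
    simp only [lengthBar]
    fun_prop

theorem sqrt_timeBar_sq_add {a θ : ℝ} (ha : 0 ≤ a) (hθ : 0 ≤ θ) :
    √(B.timeBar m k a ^ 2 + B.timeBar m k θ ^ 2) = B.timeBar m k (a + θ) := by
  rw [B.timeBar_sq m k ha, B.timeBar_sq m k hθ, ← Real.sqrt_sq (B.timeBar_nonneg m k (a + θ)),
    B.timeBar_sq m k (by positivity)]
  congr 1
  ring

/-- Once segment `k` is over, the temperature rise it has caused evolves by free diffusion. -/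
theorem diffuse_rise {t θ : ℝ} (ht : B.tf k ≤ t) (hθ : 0 < θ) (x : Space) :
    diffuse m.diffusivity θ (fun ξ => B.rise m k ξ t) x = B.rise m k x (t + θ) := by
  have hσ := B.spot_pos k
  have hκ := m.diffusivity_pos
  have hti := B.ti_lt_tf k
  rw [diffuse_rise_eq_integral _ _ _ hθ, integral_diffusedKernel _ _ _ _ _ (B.timeBar_pos m k hθ),
    B.sqrt_timeBar_sq_add m k (by linarith) hθ.le, B.sqrt_timeBar_sq_add m k (by linarith) hθ.le,
    rise_eq_integral, sub_add_eq_add_sub, sub_add_eq_add_sub]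
  have h : ∀ a b v : ℝ, B.lengthBar k (a - (b + v * (t - B.ti k)))
      - v * B.spot k / (2 * √2 * m.diffusivity) * B.timeBar m k θ ^ 2
      = B.lengthBar k (a - (b + v * (t + θ - B.ti k))) := fun a b v => by
    rw [B.timeBar_sq m k hθ.le, lengthBar, lengthBar]
    field_simp
    ring
  rw [vxBar, vyBar, h, h]

theorem contribution_eq_diffuse_rise (t : ℝ) (x : Space) :
    B.contribution m k x t
      = diffuse m.diffusivity (t - B.tf k) (fun ξ => B.rise m k ξ (B.tf k)) x := by
  rw [contribution]
  congr 1
  funext ξ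
  rw [B.fluxTerm_eq_fluxFormula m k ⟨B.ti_lt_tf k, le_rfl⟩, B.rise_of_le_tf m k le_rfl]

theorem contribution_eq_rise {t : ℝ} (ht : B.tf k < t) (x : Space) :
    B.contribution m k x t = B.rise m k x t := by
  rw [contribution_eq_diffuse_rise, B.diffuse_rise m k le_rfl (sub_pos.2 ht), add_sub_cancel]

/-- At the end of its own segment, the rise is an integral from `r = 0`, so that the diffused kernel
is integrated over the whole interval of the formula. -/
theorem contribution_eq_contributionFormula {t : ℝ} (ht : B.tf k < t) (x : Space) :
    B.contribution m k x t = B.contributionFormula m k x t := by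
  rw [contribution_eq_diffuse_rise, B.diffuse_rise_eq_integral m k (sub_pos.2 ht), sub_self,
    B.timeBar_of_nonpos m k le_rfl]
  rfl

theorem contributionIntegral_eq_contributionFormula {t : ℝ} (ht : B.tf k < t) (x : Space) :
    B.contributionIntegral m k x t = B.contributionFormula m k x t := by
  simp only [contributionIntegral, contributionFormula]
  rw [div_eq_mul_one_div, mul_assoc, ← intervalIntegral.integral_const_mul]
  congr 1
  refine intervalIntegral.integral_congr_ae (Eventually.of_forall fun r hr => ?_)
  rw [uIoc_of_le (B.timeBar_nonneg m k _)] at hr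
  exact gaussianIntegrals_eq_diffusedKernel _ _ _ _ _ (B.timeBar_pos m k (sub_pos.2 ht)) hr.1

/-! ### The solution -/

/-- The solution of the heat conduction problem. -/
noncomputable def temperature (uInit : ℝ) (x : Space) (t : ℝ) : ℝ :=
  uInit + ∑ k, B.rise m k x t

/-- The flux is the sum of the fluxes of the beams switched on, minus those switched off. Off the
segments both sides vanish, since the power is zero there. -/
theorem flux_eq_sum (x y t : ℝ) :
    B.flux x y t = ∑ k, ((if B.ti k < t then B.lineFlux k x y t else 0)
      - if B.tf k < t then B.lineFlux k x y t else 0) := by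
  have h1 : ∀ k, ((if B.ti k < t then B.lineFlux k x y t else 0)
      - if B.tf k < t then B.lineFlux k x y t else 0)
      = (B.segment k).indicator (B.lineFlux k x y) t := fun k => by
    have := B.ti_lt_tf k
    by_cases h1 : B.ti k < t <;> by_cases h2 : B.tf k < t
    · simp [h1, h2, segment]
    · simp [h1, h2, segment, not_lt.1 h2]
    · exact absurd (this.trans h2) h1
    · simp [h1, h2, segment]
  simp only [h1]
  change _ = B.piecewise (fun k => B.lineFlux k x y) t
  by_cases h : ∃ n, t ∈ B.segment n
  · obtain ⟨n, hn⟩ := h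
    rw [B.flux_eq_lineFlux n hn, B.piecewise_eq _ n hn]
  · push Not at h
    have h2 : ∀ f : Fin N → ℝ → ℝ, B.piecewise f t = 0 := fun f =>
      Finset.sum_eq_zero fun k _ => indicator_of_notMem (h k) _
    rw [flux, powerAt, h2, h2, zero_div, zero_mul]

theorem isBoundedSolution_temperature (uInit : ℝ) :
    IsBoundedSolution m B.flux B.endTime uInit (B.temperature m uInit) := by
  have h := (IsBoundedSolution.const m B.endTime uInit).add
    (IsBoundedSolution.sum Finset.univ fun k _ => by
      simpa only [sub_zero] using
        (B.isBoundedSolution_potential m k (B.ti_nonneg k) B.endTime).sub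
        (B.isBoundedSolution_potential m k
          ((B.ti_nonneg k).trans (B.ti_lt_tf k).le) B.endTime))
  simp only [zero_add, add_zero, ← flux_eq_sum] at h
  exact h

theorem temperature_eq (uInit : ℝ) {n : Fin N} {t : ℝ} (ht : t ≤ B.tf n) (x : Space) :
    B.temperature m uInit x t
      = uInit + (∑ k ∈ Finset.Iio n, B.rise m k x t) + B.rise m n x t := by
  rw [temperature, add_assoc, ← Finset.sum_subset (Finset.subset_univ (Finset.Iic n)),
    ← Finset.Iio_insert, Finset.sum_insert (by simp), add_comm (B.rise m n x t)]
  intro k _ hk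
  have hk : n < k := by simpa using hk
  exact B.rise_of_le_ti m k (ht.trans (B.tf_le_ti hk)) x

/-- The initial value term. By uniqueness, the temperature at the start of segment `n` is the sum of
the rises due to the finished segments, and these evolve by free diffusion. -/
theorem initialTerm_eq {uInit : ℝ} {u : Space → ℝ → ℝ}
    (hu : IsBoundedSolution m B.flux B.endTime uInit u) {n : Fin N} {t : ℝ}
    (ht : t ∈ B.segment n) (x : Space) :
    B.initialTerm m u n x t = uInit + ∑ k ∈ Finset.Iio n, B.rise m k x t := by
  have hθ : 0 < t - B.ti n := sub_pos.2 ht.1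
  have h1 : (evenExtension fun ξ => u ξ (B.ti n))
      = fun ξ => uInit + ∑ k ∈ Finset.Iio n, B.rise m k ξ (B.ti n) := by
    funext ξ
    rw [evenExtension, hu.eq_of_same_data (B.isBoundedSolution_temperature m uInit) (by simp)
      ⟨B.ti_nonneg n, (B.ti_lt_tf n).le.trans (B.tf_le_endTime n)⟩,
      B.temperature_eq m uInit (B.ti_lt_tf n).le, B.rise_of_le_ti m n le_rfl, add_zero]
    simp only [rise_even]
  rw [initialTerm, h1, diffuse_const_add_sum m.diffusivity_pos hθ _ _
    (fun k _ => B.measurable_rise m k _) (fun k _ ξ => B.abs_rise_le m k ξ _)]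
  congr 1
  refine Finset.sum_congr rfl fun k hk => ?_
  rw [B.diffuse_rise m k (B.tf_le_ti (Finset.mem_Iio.1 hk)) hθ, add_sub_cancel]

end BeamSchedule

end BeamHeat

theorem proposition1 {N : ℕ} (B : BeamHeat.BeamSchedule N) (m : BeamHeat.Material) (uInit : ℝ) :
    -- the problem has a bounded solution, and every one of them has the stated representation
    (∃ u, BeamHeat.IsBoundedSolution m B.flux B.endTime uInit u) ∧
    (∀ u, BeamHeat.IsBoundedSolution m B.flux B.endTime uInit u →
      ∀ n : Fin N, ∀ t ∈ B.segment n, ∀ x : BeamHeat.Space, x 2 ≤ 0 →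
        u x t = B.initialTerm m u n x t + B.fluxTerm m n x t ∧
        B.initialTerm m u n x t = uInit + (∑ k ∈ Finset.Iio n, B.contribution m k x t) ∧
        u x t = uInit + (∑ k ∈ Finset.Iio n, B.contributionFormula m k x t)
          + B.fluxFormula m n x t) ∧
    -- the flux terms
    (∀ n : Fin N, ∀ t ∈ B.segment n, ∀ x : BeamHeat.Space,
      B.fluxTerm m n x t = B.fluxFormula m n x t) ∧
    -- the contributions of the earlier segments
    (∀ n : Fin N, ∀ k < n, ∀ t ∈ B.segment n, ∀ x : BeamHeat.Space,
      B.contribution m k x t = B.contributionIntegral m k x t ∧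
      B.contribution m k x t = B.contributionFormula m k x t) ∧
    -- the Gaussian integrals over space in closed form
    (∀ v x τ r : ℝ, 0 < τ → 0 < r →
      BeamHeat.lateralIntegral v x τ r =
        √(Real.pi * τ ^ 2 * (1 + r ^ 2) / (1 + r ^ 2 + τ ^ 2)) *
          Real.exp (-((x + v * r ^ 2) ^ 2 / (1 + r ^ 2 + τ ^ 2)))) ∧
    (∀ z τ r : ℝ, 0 < τ → 0 < r →
      BeamHeat.verticalIntegral z τ r =
        √(Real.pi * τ ^ 2 * r ^ 2 / (r ^ 2 + τ ^ 2)) *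
          Real.exp (-(z ^ 2 / (r ^ 2 + τ ^ 2)))) := by
  have hlt : ∀ {n k : Fin N} {t : ℝ}, k < n → t ∈ B.segment n → B.tf k < t :=
    fun hk ht => (B.tf_le_ti hk).trans_lt ht.1
  refine ⟨⟨_, B.isBoundedSolution_temperature m uInit⟩, fun u hu n t ht x hx => ?_,
    fun n t ht x => B.fluxTerm_eq_fluxFormula m n ht x, fun n k hk t ht x => ?_,
    fun v x τ r hτ _ => BeamHeat.lateralIntegral_eq v x hτ r,
    fun z τ r hτ hr => BeamHeat.verticalIntegral_eq z hτ hr⟩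
  · have h1 : u x t = uInit + (∑ k ∈ Finset.Iio n, B.rise m k x t) + B.fluxFormula m n x t := by
      rw [hu.eq_of_same_data (B.isBoundedSolution_temperature m uInit) hx
        ⟨(B.ti_nonneg n).trans ht.1.le, ht.2.trans (B.tf_le_endTime n)⟩,
        B.temperature_eq m uInit ht.2, B.rise_of_le_tf m n ht.2]
    have h2 : ∀ k ∈ Finset.Iio n, B.contribution m k x t = B.rise m k x t := fun k hk =>
      B.contribution_eq_rise m k (hlt (Finset.mem_Iio.1 hk) ht) x
    have h3 : ∀ k ∈ Finset.Iio n, B.contribution m k x t = B.contributionFormula m k x t :=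
      fun k hk => B.contribution_eq_contributionFormula m k (hlt (Finset.mem_Iio.1 hk) ht) x
    refine ⟨?_, ?_, ?_⟩
    · rw [h1, B.initialTerm_eq m hu ht, B.fluxTerm_eq_fluxFormula m n ht]
    · rw [B.initialTerm_eq m hu ht, Finset.sum_congr rfl h2]
    · rw [h1, ← Finset.sum_congr rfl h2, Finset.sum_congr rfl h3]
  · have h1 := B.contribution_eq_contributionFormula m k (hlt hk ht) x
    exact ⟨h1.trans (B.contributionIntegral_eq_contributionFormula m k (hlt hk ht) x).symm, h1⟩
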